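/- **Definitions.** Let $T$ be a string of length $n\ge 1$ over an alphabet of integers; its positions are numbered $0,\dots,n-1$. A *phrase* is either a character phrase $c$, of length $1$, or a target phrase $\langle t,\ell\rangle$ with reference position $t$ and length $\ell\ge 1$. *Partial bidirectional phrases* (PBP) of $T$ are a sequence $P=f_1,\dots,f_k$ of phrases that partitions a prefix of $T$, where a character phrase starting at position $s$ is the character $T[s]$, and a target phrase $\langle t,\ell\rangle$ starting at $s$ satisfies $t\ne s$ and $T[s..s+\ell-1]=T[t..t+\ell-1]$ (both substrings lying inside $T$). They are *bidirectional phrases* (BP) of $T$ if they partition all of $T$. A BP $B$ of $T$ is *valid* if it has no infinite loop of references, that is, if from every position $x$ of $T$ a character phrase is reached by repeatedly replacing a position $s+k$ on a target phrase $\langle t,\ell\rangle$ starting at $s$ by $t+k$. A PBP $P$ of $T$ is *valid* if the BP that consists of $P$ followed by one character phrase for each remaining position of $T$ is valid. For a PBP $P$, let $\mathsf{LP}(P)$ be a longest phrase $f$ such that $P\cdot f$ is a valid PBP of $T$; it is a character phrase only if there is no target phrase $f$ for which $P\cdot f$ is a valid PBP. A sequence of *LZRR phrases* of $T$, denoted $\mathsf{LZRR}(T)$,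 is a valid BP $f_1,\dots,f_b$ of $T$ with $f_{p+1}=\mathsf{LP}(f_1,\dots,f_p)$ for all $0\le p<b$ (it need not be unique). Let $A$ be the Ackermann function ($A(0,y)=y+1$, $A(k+1,0)=A(k,1)$, $A(k+1,y+1)=A(k,A(k+1,y))$), and let $\alpha_k(x)=\min\{y\ge 1 : A(k,y)\ge x\}$ be the inverse of its $k$-th row. **Theorem.** $\mathsf{LZRR}(T)$ can be computed in $O(n^2\,\alpha_{n^2}(n^2))$ time using $O(n)$ words of working space on a unit-cost word RAM. Precisely: there are a word RAM program and constants $C,K$ such that for every word size $w$ and every string $T$ of length $n\ge 1$ whose characters are $w$-bit words, with $2^w\ge K n$ (that is, $w\ge \log_2 n+O(1)$), the program, started with $n$ and $T$ as input, halts after at most $C\,n^2\,\alpha_{n^2}(n^2)$ unit-cost steps, uses only the first $C\,n$ memory cells (input and output included), and outputs a sequence of LZRR phrases of $T$. -/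

import Mathlib

/-! ### Bidirectional phrases

Strings are lists of natural numbers (characters are identified with machine words), and the
positions of a string of length `n` are `0, …, n - 1`. -/

/-- A phrase is an explicit character, or a target phrase `⟨t, ℓ⟩` with reference position `t`
and length `ℓ`. -/
inductive Phrase where
  | char (c : ℕ)
  | target (t ℓ : ℕ)
  deriving DecidableEq

namespace Phrase

/-- The length of the substring that a phrase stands for. -/
def length : Phrase → ℕ
  | char _ => 1
  | target _ ℓ => ℓ

/-- Character phrases, as opposed to target phrases. -/
def IsChar : Phrase → Prop
  | char _ => True
  | target _ _ => False

/-- The phrase stored in two machine words: `(a, 0)` is the character phrase `a`, and `(a, ℓ)`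
with `ℓ ≥ 1` is the target phrase `⟨a, ℓ⟩`. -/
def decode (a ℓ : ℕ) : Phrase := if ℓ = 0 then char a else target a ℓ

end Phrase

namespace LZRR

/-- The length of the string that a sequence of phrases stands for. -/
def totalLength (P : List Phrase) : ℕ := (P.map Phrase.length).sum

/-- The phrases partition a substring of `T` beginning at `s`; a target phrase is a copy of another
substring of `T`, with a reference position different from its own starting position. -/
def IsPBPFrom (T : List ℕ) : ℕ → List Phrase → Prop
  | _, [] => True
  | s, .char c :: P => T[s]? = some c ∧ IsPBPFrom T (s + 1) P
  | s, .target t ℓ :: P =>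
      1 ≤ ℓ ∧ t ≠ s ∧ s + ℓ ≤ T.length ∧ t + ℓ ≤ T.length ∧
        (∀ k < ℓ, T[s + k]? = T[t + k]?) ∧ IsPBPFrom T (s + ℓ) P

/-- Partial bidirectional phrases: phrases that partition a prefix of `T`. -/
def IsPBP (T : List ℕ) (P : List Phrase) : Prop := IsPBPFrom T 0 P

/-- Bidirectional phrases: phrases that partition `T`. -/
def IsBP (T : List ℕ) (B : List Phrase) : Prop := IsPBP T B ∧ totalLength B = T.length

/-- One reference from position `x`, where the first phrase of the list starts at `s ≤ x`: the
character (`Sum.inr`) if `x` is on a character phrase, and otherwise the position (`Sum.inl`) from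
which `x` is copied. The value on the empty list is irrelevant: `x` is on no phrase. -/
def refFrom : ℕ → List Phrase → ℕ → ℕ ⊕ ℕ
  | _, [], x => .inl x
  | s, .char c :: B, x => if x < s + 1 then .inr c else refFrom (s + 1) B x
  | s, .target t ℓ :: B, x => if x < s + ℓ then .inl (t + (x - s)) else refFrom (s + ℓ) B x

/-- `iterRef B k x` is `g^k(x)`: `g^0` makes one reference, and `g^(k+1)` makes one more reference
unless a character has been reached. -/
def iterRef (B : List Phrase) : ℕ → ℕ → ℕ ⊕ ℕ
  | 0, x => refFrom 0 B x
  | k + 1, x =>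
      match iterRef B k x with
      | .inr c => .inr c
      | .inl y => refFrom 0 B y

/-- Valid bidirectional phrases of `T`: no infinite loop of references, i.e. `g^n(x)` is a character
for every position `x`. -/
def IsValidBP (T : List ℕ) (B : List Phrase) : Prop :=
  IsBP T B ∧ ∀ x < T.length, (iterRef B T.length x).isRight

/-- The phrases of `P` followed by character phrases for the rest of `T`. -/
def complete (T : List ℕ) (P : List Phrase) : List Phrase :=
  P ++ (T.drop (totalLength P)).map Phrase.char

/-- Valid partial bidirectional phrases of `T`. -/
def IsValidPBP (T : List ℕ) (P : List Phrase) : Prop := IsPBP T P ∧ IsValidBP T (complete T P)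

/-- `f` is a possible value of `LP(P)`: a longest phrase for which `P · f` is valid, where a
character phrase is chosen only if no target phrase is possible. -/
def IsLP (T : List ℕ) (P : List Phrase) (f : Phrase) : Prop :=
  IsValidPBP T (P ++ [f]) ∧
  (∀ f', IsValidPBP T (P ++ [f']) → f'.length ≤ f.length) ∧
  (f.IsChar → ∀ t ℓ, ¬ IsValidPBP T (P ++ [.target t ℓ]))

/-- `B` is a sequence of LZRR phrases of `T`: valid bidirectional phrases of `T`, each of which is
`LP` of the sequence of phrases before it. -/
def IsLZRR (T : List ℕ) (B : List Phrase) : Prop :=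
  IsValidBP T B ∧ ∀ (p : ℕ) (hp : p < B.length), IsLP T (B.take p) B[p]

/-- `invAck k x` is `α_k(x)`, the inverse of the `k`-th row of the Ackermann function: the least
`y ≥ 1` with `A(k, y) ≥ x`. -/
def invAck (k x : ℕ) : ℕ :=
  Nat.find (p := fun y => 1 ≤ y ∧ x ≤ ack k y)
    ⟨x + 1, by omega, by have := lt_ack_right k (x + 1); omega⟩

end LZRR

/-! ### The word RAM -/

namespace WordRAM

/-- The binary operations of the word RAM. -/
inductive BinOp where
  | add | sub | mul | div | mod | and | or | xor | shl | shr

/-- The value of an operation on words of `w` bits, i.e. on numbers below `2 ^ w`; arithmetic is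
modulo `2 ^ w`. -/
def BinOp.eval (w : ℕ) : BinOp → ℕ → ℕ → ℕ
  | add, a, b => (a + b) % 2 ^ w
  | sub, a, b => (a + (2 ^ w - b)) % 2 ^ w
  | mul, a, b => (a * b) % 2 ^ w
  | div, a, b => a / b
  | mod, a, b => a % b
  | and, a, b => a &&& b
  | or, a, b => a ||| b
  | xor, a, b => a ^^^ b
  | shl, a, b => (a <<< b) % 2 ^ w
  | shr, a, b => a >>> b

/-- Instructions, with `R` the registers and `M` the memory. A program names finitely many
registers, the same for all inputs. -/
inductive Instr where
  /-- `R[d] := c mod 2 ^ w` -/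
  | const (d c : ℕ)
  /-- `R[d] := R[a] o R[b]` -/
  | op (o : BinOp) (d a b : ℕ)
  /-- `R[d] := M[R[a]]` -/
  | load (d a : ℕ)
  /-- `M[R[a]] := R[b]` -/
  | store (a b : ℕ)
  /-- go to instruction `l` -/
  | jump (l : ℕ)
  /-- go to instruction `l` if `R[a] = R[b]` -/
  | jumpEq (a b l : ℕ)
  /-- go to instruction `l` if `R[a] < R[b]` -/
  | jumpLt (a b l : ℕ)

abbrev Program := List Instr

structure Config where
  pc : ℕ
  reg : ℕ → ℕ
  mem : ℕ → ℕ

/-- The effect of one instruction. -/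
def Instr.exec (w : ℕ) (c : Config) : Instr → Config
  | const d v => ⟨c.pc + 1, Function.update c.reg d (v % 2 ^ w), c.mem⟩
  | op o d a b => ⟨c.pc + 1, Function.update c.reg d (o.eval w (c.reg a) (c.reg b)), c.mem⟩
  | load d a => ⟨c.pc + 1, Function.update c.reg d (c.mem (c.reg a)), c.mem⟩
  | store a b => ⟨c.pc + 1, c.reg, Function.update c.mem (c.reg a) (c.reg b)⟩
  | jump l => ⟨l, c.reg, c.mem⟩
  | jumpEq a b l => ⟨if c.reg a = c.reg b then l else c.pc + 1, c.reg, c.mem⟩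
  | jumpLt a b l => ⟨if c.reg a < c.reg b then l else c.pc + 1, c.reg, c.mem⟩

/-- The memory address that an instruction reads or writes, if any. -/
def Instr.address (c : Config) : Instr → Option ℕ
  | load _ a => some (c.reg a)
  | store a _ => some (c.reg a)
  | _ => none

/-- The machine halts when the program counter leaves the program. -/
def Halted (prog : Program) (c : Config) : Prop := prog.length ≤ c.pc

/-- One step, of unit cost; a halted configuration stays as it is. -/
def step (w : ℕ) (prog : Program) (c : Config) : Config :=
  match prog[c.pc]? with
  | some i => i.exec w c
  | none => c

/-- The memory address that the next step reads or writes, if any. -/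
def nextAddress (prog : Program) (c : Config) : Option ℕ := prog[c.pc]?.bind (·.address c)

/-- The initial configuration: `n` is in register 0, the `n` characters of the input are in the
memory cells `0, …, n - 1`, and all other registers and cells are 0. -/
def init (T : List ℕ) : Config where
  pc := 0
  reg := fun r => if r = 0 then T.length else 0
  mem := fun a => T.getD a 0

/-- `Computes w prog T time space out`: on words of `w` bits, `prog` started on `T` halts after at
most `time` steps, uses no memory cell outside the cells `0, …, space - 1` (the cells of the input
and the output included), and in the end register 0 holds a number `b` and register 1 an address
`a` such that the `2 b` cells beginning at `a` store the `b` phrases of `out`. -/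
def Computes (w : ℕ) (prog : Program) (T : List ℕ) (time space : ℕ) (out : List Phrase) : Prop :=
  ∃ t ≤ time,
    let c := (step w prog)^[t] (init T)
    Halted prog c ∧
    (∀ s < t, ∀ a ∈ nextAddress prog ((step w prog)^[s] (init T)), a < space) ∧
    c.reg 1 + 2 * c.reg 0 ≤ space ∧
    out = (List.range (c.reg 0)).map fun p =>
      Phrase.decode (c.mem (c.reg 1 + 2 * p)) (c.mem (c.reg 1 + 2 * p + 1))

end WordRAM

/-! Since $A(k,1) > k$, the factor $\alpha_{n^2}(n^2)$ equals 1 (`invAck_self`). A quadratic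
algorithm is therefore needed, and a plain table of roots can serve instead of a union-find
structure.

A sequence of phrases is read as a parent function on positions, whose roots are the positions on
character phrases or on no phrase. It is valid if and only if every position has a root
(`isValidPBP_iff`). A target phrase $\langle t,\ell\rangle$ at $s$ adds references out of the roots
$s, \dots, s+\ell-1$. After contracting each old tree to its root, validity says that every walk of
$y \mapsto \mathrm{root}(t+(y-s))$ leaves $[s,s+\ell)$ (`exists_rootOf_graft_iff`). Walks that mark
what they visit decide this in $O(\ell)$ steps.

Shortening a target phrase keeps it valid (`IsValidPBP.target_mono`). Hence the longest phrase is
found with two pointers, a reference position $t$ and a length $l$ reached so far. The phrase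
$\langle t,l+1\rangle$ is tested; success raises $l$, failure discards $t$ for good. This makes at
most $2n$ tests of cost $O(M+1)$, where $M$ is the final length, or 0 if only a character is
possible. The phrase covers $\max(M,1)$ positions, so all searches together take $O(n^2)$. Adding
one reference relabels the table of roots in one scan (`rootOf_update`), again $O(n)$ for each
position of the text.

On the machine side, a small structured language is compiled to the word RAM. Programs are verified
by weakest preconditions with time credits, so that termination, running time and space come out of
the same argument as correctness. -/

/-! ### A structured language over the word RAM -/

namespace WordRAM

/-- The registers and the memory of a machine. -/
structure State where
  reg : ℕ → ℕ
  mem : ℕ → ℕ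

/-- The configuration with program counter `pc` in a given state. -/
def State.at (σ : State) (pc : ℕ) : Config := ⟨pc, σ.reg, σ.mem⟩

/-- Comparisons of two registers. -/
inductive Cond where
  | lt (a b : ℕ)
  | eq (a b : ℕ)

/-- A comparison holds in a state. -/
def Cond.Holds (σ : State) : Cond → Prop
  | lt a b => σ.reg a < σ.reg b
  | eq a b => σ.reg a = σ.reg b

/-- The jump to `l` under a condition. -/
def Cond.jump (l : ℕ) : Cond → Instr
  | lt a b => .jumpLt a b l
  | eq a b => .jumpEq a b l

/-- Structured programs. -/
inductive Stmt where
  | skip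
  | const (d c : ℕ)
  | add (d a b : ℕ)
  | sub (d a b : ℕ)
  | load (d a : ℕ)
  | store (a b : ℕ)
  | seq (s₁ s₂ : Stmt)
  | ite (c : Cond) (s₁ s₂ : Stmt)
  | loop (c : Cond) (s : Stmt)

namespace Stmt

/-- The number of instructions of the compiled program. -/
def size : Stmt → ℕ
  | skip => 0
  | const _ _ => 1
  | add _ _ _ => 1
  | sub _ _ _ => 1
  | load _ _ => 1
  | store _ _ => 1
  | seq s₁ s₂ => s₁.size + s₂.size
  | ite _ s₁ s₂ => s₁.size + s₂.size + 2
  | loop _ s => s.size + 3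

/-- The compiled program, to be placed at address `o`. -/
def compile : Stmt → ℕ → Program
  | skip, _ => []
  | const d c, _ => [.const d c]
  | add d a b, _ => [.op .add d a b]
  | sub d a b, _ => [.op .sub d a b]
  | load d a, _ => [.load d a]
  | store a b, _ => [.store a b]
  | seq s₁ s₂, o => s₁.compile o ++ s₂.compile (o + s₁.size)
  -- The second branch comes first, because a comparison jumps only when it holds. Hence a true
  -- condition costs one extra step and a false one two, the second being the jump over the other
  -- branch.
  | ite c s₁ s₂, o =>
      c.jump (o + s₂.size + 2) :: (s₂.compile (o + 1) ++
        .jump (o + s₂.size + 2 + s₁.size) :: s₁.compile (o + s₂.size + 2))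
  | loop c s, o =>
      c.jump (o + 2) :: .jump (o + s.size + 3) :: (s.compile (o + 2) ++ [.jump o])

/-- The registers that a program may change. -/
def writes : Stmt → List ℕ
  | skip => []
  | const d _ => [d]
  | add d _ _ => [d]
  | sub d _ _ => [d]
  | load d _ => [d]
  | store _ _ => []
  | seq s₁ s₂ => s₁.writes ++ s₂.writes
  | ite _ s₁ s₂ => s₁.writes ++ s₂.writes
  | loop _ s => s.writes

theorem length_compile (s : Stmt) (o : ℕ) : (s.compile o).length = s.size := by
  induction s generalizing o with
  | seq s₁ s₂ h₁ h₂ => simp [compile, size, h₁, h₂]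
  | ite c s₁ s₂ h₁ h₂ => simp [compile, size, h₁, h₂]; omega
  | loop c s h => simp [compile, size, h]
  | _ => rfl

end Stmt

/-- Big-step semantics: `Run w S s σ σ' t` says that `s`, started in `σ`, ends in `σ'` after
`t` machine steps, without arithmetic overflow and without touching a cell outside `0, …, S - 1`. -/
inductive Run (w S : ℕ) : Stmt → State → State → ℕ → Prop
  | skip (σ) : Run w S .skip σ σ 0
  | const (σ : State) (d c : ℕ) (h : c < 2 ^ w) :
      Run w S (.const d c) σ ⟨Function.update σ.reg d c, σ.mem⟩ 1
  | add (σ : State) (d a b : ℕ) (h : σ.reg a + σ.reg b < 2 ^ w) :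
      Run w S (.add d a b) σ ⟨Function.update σ.reg d (σ.reg a + σ.reg b), σ.mem⟩ 1
  | sub (σ : State) (d a b : ℕ) (h : σ.reg b ≤ σ.reg a) (h' : σ.reg a < 2 ^ w) :
      Run w S (.sub d a b) σ ⟨Function.update σ.reg d (σ.reg a - σ.reg b), σ.mem⟩ 1
  | load (σ : State) (d a : ℕ) (h : σ.reg a < S) :
      Run w S (.load d a) σ ⟨Function.update σ.reg d (σ.mem (σ.reg a)), σ.mem⟩ 1
  | store (σ : State) (a b : ℕ) (h : σ.reg a < S) :
      Run w S (.store a b) σ ⟨σ.reg, Function.update σ.mem (σ.reg a) (σ.reg b)⟩ 1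
  | seq {s₁ s₂ σ₁ σ₂ σ₃ t₁ t₂} : Run w S s₁ σ₁ σ₂ t₁ → Run w S s₂ σ₂ σ₃ t₂ →
      Run w S (.seq s₁ s₂) σ₁ σ₃ (t₁ + t₂)
  | iteTrue {c s₁ s₂ σ σ' t} : c.Holds σ → Run w S s₁ σ σ' t → Run w S (.ite c s₁ s₂) σ σ' (t + 1)
  | iteFalse {c s₁ s₂ σ σ' t} : ¬ c.Holds σ → Run w S s₂ σ σ' t →
      Run w S (.ite c s₁ s₂) σ σ' (t + 2)
  | loopTrue {c s σ₁ σ₂ σ₃ t₁ t₂} : c.Holds σ₁ → Run w S s σ₁ σ₂ t₁ →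
      Run w S (.loop c s) σ₂ σ₃ t₂ → Run w S (.loop c s) σ₁ σ₃ (t₁ + t₂ + 2)
  | loopFalse {c s σ} : ¬ c.Holds σ → Run w S (.loop c s) σ σ 2

/-- A run changes only the registers in `Stmt.writes`. -/
theorem Run.reg_eq {w S s σ σ' t} (h : Run w S s σ σ' t) :
    ∀ r ∉ s.writes, σ'.reg r = σ.reg r := by
  induction h with
  | seq _ _ h₁ h₂ =>
    intro r hr
    simp only [Stmt.writes, List.mem_append, not_or] at hr
    rw [h₂ r hr.2, h₁ r hr.1]
  | iteTrue _ _ h =>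
    intro r hr
    simp only [Stmt.writes, List.mem_append, not_or] at hr
    exact h r hr.1
  | iteFalse _ _ h =>
    intro r hr
    simp only [Stmt.writes, List.mem_append, not_or] at hr
    exact h r hr.2
  | loopTrue _ _ _ h₁ h₂ => intro r hr; rw [h₂ r hr, h₁ r hr]
  | _ => intro r hr; simp_all [Stmt.writes]

/-! ### Correctness of the compilation -/

/-- `Reach w S prog c t c'`: in `t` steps the machine goes from `c` to `c'`, touching only the
cells `0, …, S - 1`. -/
inductive Reach (w S : ℕ) (prog : Program) : Config → ℕ → Config → Prop
  | refl (c) : Reach w S prog c 0 c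
  | head {c t c'} (i : Instr) : prog[c.pc]? = some i → (∀ a ∈ i.address c, a < S) →
      Reach w S prog (i.exec w c) t c' → Reach w S prog c (t + 1) c'

theorem Reach.trans {w S prog c₁ c₂ c₃ t₁ t₂} (h₁ : Reach w S prog c₁ t₁ c₂)
    (h₂ : Reach w S prog c₂ t₂ c₃) : Reach w S prog c₁ (t₁ + t₂) c₃ := by
  induction h₁ with
  | refl => simpa using h₂
  | head i hi ha _ ih =>
    rw [Nat.add_right_comm]
    exact .head i hi ha (ih h₂)

theorem Reach.single {w S prog} {c c' : Config} (i : Instr) (hi : prog[c.pc]? = some i)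
    (ha : ∀ a ∈ i.address c, a < S) (h : i.exec w c = c') : Reach w S prog c 1 c' :=
  .head i hi ha (h ▸ .refl _)

theorem Reach.iterate {w S prog c t c'} (h : Reach w S prog c t c') :
    (step w prog)^[t] c = c' ∧
      ∀ s < t, ∀ a ∈ nextAddress prog ((step w prog)^[s] c), a < S := by
  induction h with
  | refl => simp
  | @head c t c' i hi ha _ ih =>
    have hs : step w prog c = i.exec w c := by simp [step, hi]
    refine ⟨by rw [Function.iterate_succ_apply, hs, ih.1], fun s hs' => ?_⟩
    cases s with
    | zero => simpa [nextAddress, hi] using ha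
    | succ s =>
      rw [Function.iterate_succ_apply, hs]
      exact ih.2 s (by omega)

/-- The instructions `l` are found in `prog` from address `o` on. -/
def CodeAt (prog : Program) : ℕ → Program → Prop
  | _, [] => True
  | o, i :: l => prog[o]? = some i ∧ CodeAt prog (o + 1) l

theorem codeAt_append {prog : Program} {l₁ l₂ : Program} {o : ℕ} :
    CodeAt prog o (l₁ ++ l₂) ↔ CodeAt prog o l₁ ∧ CodeAt prog (o + l₁.length) l₂ := by
  induction l₁ generalizing o with
  | nil => simp [CodeAt]
  | cons i l ih => simp [CodeAt, ih, and_assoc, Nat.add_assoc, Nat.add_comm 1]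

theorem codeAt_self (l₁ l₂ : Program) : CodeAt (l₁ ++ l₂) l₁.length l₂ := by
  induction l₂ generalizing l₁ with
  | nil => trivial
  | cons i l ih =>
    refine ⟨by simp, ?_⟩
    simpa using ih (l₁ ++ [i])

theorem Cond.exec_jump_of_holds {w : ℕ} {σ : State} {c : Cond} (h : c.Holds σ) (l pc : ℕ) :
    (c.jump l).exec w (σ.at pc) = σ.at l := by
  cases c <;> simp_all [Cond.Holds, Cond.jump, Instr.exec, State.at]

theorem Cond.exec_jump_of_not_holds {w : ℕ} {σ : State} {c : Cond} (h : ¬ c.Holds σ) (l pc : ℕ) :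
    (c.jump l).exec w (σ.at pc) = σ.at (pc + 1) := by
  cases c <;> simp only [Cond.Holds] at h <;> simp [Cond.jump, Instr.exec, State.at, h]

theorem Cond.address_jump (c : Cond) (l : ℕ) (k : Config) : (c.jump l).address k = none := by
  cases c <;> rfl

/-- Induction on the run. The step counts of `Run` already include the jumps inserted by the
compiler, so time is preserved exactly and not only up to a factor. -/
theorem Run.reach {w S s σ σ' t} (h : Run w S s σ σ' t) (prog : Program) (o : ℕ)
    (hc : CodeAt prog o (s.compile o)) :
    Reach w S prog (σ.at o) t (σ'.at (o + s.size)) := by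
  induction h generalizing o with
  | skip => exact .refl _
  | const σ d c h =>
    exact .single _ hc.1 (by simp [Instr.address])
      (by simp [Instr.exec, State.at, Nat.mod_eq_of_lt h, Stmt.size])
  | add σ d a b h =>
    exact .single _ hc.1 (by simp [Instr.address])
      (by simp [Instr.exec, State.at, BinOp.eval, Nat.mod_eq_of_lt h, Stmt.size])
  | sub σ d a b h h' =>
    refine .single _ hc.1 (by simp [Instr.address]) ?_
    have : (σ.reg a + (2 ^ w - σ.reg b)) % 2 ^ w = σ.reg a - σ.reg b := by
      rw [show σ.reg a + (2 ^ w - σ.reg b) = σ.reg a - σ.reg b + 2 ^ w by omega,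
        Nat.add_mod_right, Nat.mod_eq_of_lt (by omega)]
    simp [Instr.exec, State.at, BinOp.eval, this, Stmt.size]
  | load σ d a h =>
    exact .single _ hc.1 (by simpa [Instr.address, State.at] using h)
      (by simp [Instr.exec, State.at, Stmt.size])
  | store σ a b h =>
    exact .single _ hc.1 (by simpa [Instr.address, State.at] using h)
      (by simp [Instr.exec, State.at, Stmt.size])
  | seq _ _ h₁ h₂ =>
    rw [Stmt.compile, codeAt_append, Stmt.length_compile] at hc
    rw [Stmt.size, ← Nat.add_assoc]
    exact (h₁ o hc.1).trans (h₂ _ hc.2)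
  | @iteTrue c s₁ s₂ σ σ' t hh _ ih =>
    simp only [Stmt.compile, CodeAt, codeAt_append, Stmt.length_compile] at hc
    refine .head _ hc.1 (by simp [Cond.address_jump]) ?_
    rw [Cond.exec_jump_of_holds hh]
    have h := ih (o + s₂.size + 2) (by convert hc.2.2.2 using 1; omega)
    rw [Stmt.size, show o + (s₁.size + s₂.size + 2) = o + s₂.size + 2 + s₁.size by omega]
    exact h
  | @iteFalse c s₁ s₂ σ σ' t hh _ ih =>
    simp only [Stmt.compile, CodeAt, codeAt_append, Stmt.length_compile] at hc
    refine .head _ hc.1 (by simp [Cond.address_jump]) ?_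
    rw [Cond.exec_jump_of_not_holds hh]
    refine (ih (o + 1) hc.2.1).trans (.single _ hc.2.2.1 (by simp [Instr.address]) ?_)
    simp only [Instr.exec, State.at, Stmt.size]
    congr 1
    omega
  | @loopTrue c s σ₁ σ₂ σ₃ t₁ t₂ hh _ _ ih₁ ih₂ =>
    have hc' := hc
    simp only [Stmt.compile, CodeAt, codeAt_append, Stmt.length_compile] at hc
    rw [show t₁ + t₂ + 2 = (t₁ + (t₂ + 1)) + 1 by omega]
    refine .head _ hc.1 (by simp [Cond.address_jump]) ?_
    rw [Cond.exec_jump_of_holds hh]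
    exact (ih₁ (o + 2) hc.2.2.1).trans
      (.head (.jump o) hc.2.2.2.1 (by simp [Instr.address]) (ih₂ o hc'))
  | @loopFalse c s σ hh =>
    simp only [Stmt.compile, CodeAt] at hc
    refine .head _ hc.1 (by simp [Cond.address_jump]) ?_
    rw [Cond.exec_jump_of_not_holds hh]
    exact .single _ hc.2.1 (by simp [Instr.address])
      (by simp [Instr.exec, State.at, Stmt.size, Nat.add_assoc])

/-! ### Weakest preconditions with time credits -/

/-- `WP w S s σ B Q`: the program `s`, started in `σ` with `B` time credits, ends in a state `σ'`
with `B'` credits left, such that `Q σ' B'`. -/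
def WP (w S : ℕ) (s : Stmt) (σ : State) (B : ℕ) (Q : State → ℕ → Prop) : Prop :=
  ∃ σ' t, Run w S s σ σ' t ∧ t ≤ B ∧ Q σ' (B - t)

section Rules

variable {w S : ℕ} {σ : State} {B : ℕ} {Q : State → ℕ → Prop}

/-- The consequence rule includes the frame rule: specifications mention only what a program
changes, and the values of all other registers are recovered here from `Stmt.writes`. -/
theorem WP.conseq {s : Stmt} {Q' : State → ℕ → Prop} (h : WP w S s σ B Q)
    (hQ : ∀ σ' B', (∀ r ∉ s.writes, σ'.reg r = σ.reg r) → Q σ' B' → Q' σ' B') :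
    WP w S s σ B Q' := by
  obtain ⟨σ', t, hr, ht, hq⟩ := h
  exact ⟨σ', t, hr, ht, hQ _ _ hr.reg_eq hq⟩

theorem wp_skip (h : Q σ B) : WP w S .skip σ B Q := ⟨σ, 0, .skip σ, by omega, h⟩

theorem wp_const {d c : ℕ} (h : 1 ≤ B ∧ c < 2 ^ w ∧ Q ⟨Function.update σ.reg d c, σ.mem⟩ (B - 1)) :
    WP w S (.const d c) σ B Q :=
  ⟨_, 1, .const σ d c h.2.1, h.1, h.2.2⟩

theorem wp_add {d a b : ℕ} (h : 1 ≤ B ∧ σ.reg a + σ.reg b < 2 ^ w ∧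
    Q ⟨Function.update σ.reg d (σ.reg a + σ.reg b), σ.mem⟩ (B - 1)) :
    WP w S (.add d a b) σ B Q :=
  ⟨_, 1, .add σ d a b h.2.1, h.1, h.2.2⟩

theorem wp_sub {d a b : ℕ} (h : 1 ≤ B ∧ σ.reg b ≤ σ.reg a ∧ σ.reg a < 2 ^ w ∧
    Q ⟨Function.update σ.reg d (σ.reg a - σ.reg b), σ.mem⟩ (B - 1)) :
    WP w S (.sub d a b) σ B Q :=
  ⟨_, 1, .sub σ d a b h.2.1 h.2.2.1, h.1, h.2.2.2⟩

theorem wp_load {d a : ℕ} (h : 1 ≤ B ∧ σ.reg a < S ∧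
    Q ⟨Function.update σ.reg d (σ.mem (σ.reg a)), σ.mem⟩ (B - 1)) :
    WP w S (.load d a) σ B Q :=
  ⟨_, 1, .load σ d a h.2.1, h.1, h.2.2⟩

theorem wp_store {a b : ℕ} (h : 1 ≤ B ∧ σ.reg a < S ∧
    Q ⟨σ.reg, Function.update σ.mem (σ.reg a) (σ.reg b)⟩ (B - 1)) :
    WP w S (.store a b) σ B Q :=
  ⟨_, 1, .store σ a b h.2.1, h.1, h.2.2⟩

theorem wp_seq {s₁ s₂ : Stmt} (h : WP w S s₁ σ B fun σ' B' => WP w S s₂ σ' B' Q) :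
    WP w S (.seq s₁ s₂) σ B Q := by
  obtain ⟨σ', t, hr, ht, σ'', t', hr', ht', hq⟩ := h
  exact ⟨σ'', t + t', .seq hr hr', by omega, by rwa [← Nat.sub_sub]⟩

theorem wp_ite {c : Cond} {s₁ s₂ : Stmt} (h2 : 2 ≤ B) (h₁ : c.Holds σ → WP w S s₁ σ (B - 1) Q)
    (h₂ : ¬ c.Holds σ → WP w S s₂ σ (B - 2) Q) : WP w S (.ite c s₁ s₂) σ B Q := by
  by_cases h : c.Holds σ
  · obtain ⟨σ', t, hr, ht, hq⟩ := h₁ h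
    exact ⟨σ', t + 1, .iteTrue h hr, by omega, by rwa [Nat.add_comm, ← Nat.sub_sub]⟩
  · obtain ⟨σ', t, hr, ht, hq⟩ := h₂ h
    exact ⟨σ', t + 2, .iteFalse h hr, by omega, by rwa [Nat.add_comm, ← Nat.sub_sub]⟩

/-- The rule for loops. Every round costs credits, so that no variant is needed. -/
theorem wp_loop {c : Cond} {s : Stmt} (I : State → ℕ → Prop) (h : I σ B)
    (hI : ∀ σ' B', (∀ r ∉ s.writes, σ'.reg r = σ.reg r) → I σ' B' → 2 ≤ B' ∧
      (c.Holds σ' → WP w S s σ' (B' - 2) I) ∧ (¬ c.Holds σ' → Q σ' (B' - 2))) :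
    WP w S (.loop c s) σ B Q := by
  suffices H : ∀ B' σ', (∀ r ∉ s.writes, σ'.reg r = σ.reg r) → I σ' B' →
      WP w S (.loop c s) σ' B' Q from H B σ (fun _ _ => rfl) h
  intro B'
  induction B' using Nat.strong_induction_on with
  | _ B' ih =>
    intro σ' hf hi
    obtain ⟨h2, ht, hn⟩ := hI σ' B' hf hi
    by_cases hc : c.Holds σ'
    · obtain ⟨σ₁, t₁, hr, ht₁, hi₁⟩ := ht hc
      obtain ⟨σ₂, t₂, hr', ht₂, hq⟩ := ih (B' - 2 - t₁) (by omega) σ₁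
        (fun r hr' => (hr.reg_eq r hr').trans (hf r hr')) hi₁
      refine ⟨σ₂, t₁ + t₂ + 2, .loopTrue hc hr hr', by omega, ?_⟩
      rwa [show B' - (t₁ + t₂ + 2) = B' - 2 - t₁ - t₂ by omega]
    · exact ⟨σ', 2, .loopFalse hc, h2, hn hc⟩

end Rules

/-- A verified structured program, compiled, runs on the machine within its credits. -/
theorem WP.exists_iterate {w S : ℕ} {s : Stmt} {σ : State} {B : ℕ} {Q : State → ℕ → Prop}
    (h : WP w S s σ B Q) :
    ∃ t ≤ B, ∃ σ' B', Q σ' B' ∧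
      (step w (s.compile 0))^[t] (σ.at 0) = σ'.at (s.compile 0).length ∧
      ∀ u < t, ∀ a ∈ nextAddress (s.compile 0) ((step w (s.compile 0))^[u] (σ.at 0)), a < S := by
  obtain ⟨σ', t, hr, ht, hq⟩ := h
  have := (hr.reach (s.compile 0) 0 (codeAt_self [] _)).iterate
  rw [Nat.zero_add] at this
  refine ⟨t, ht, σ', _, hq, ?_⟩
  rw [Stmt.length_compile]
  exact this

end WordRAM

/-! ### Reference forests -/

namespace LZRR

/-- `RootOf par x y`: following the parent function `par` from `x`, one arrives at its fixed
point `y`. -/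
inductive RootOf (par : ℕ → ℕ) : ℕ → ℕ → Prop
  | base {x} : par x = x → RootOf par x x
  | step {x y} : par x ≠ x → RootOf par (par x) y → RootOf par x y

theorem RootOf.fixed {par : ℕ → ℕ} {x y : ℕ} (h : RootOf par x y) : par y = y := by
  induction h with
  | base h => exact h
  | step _ _ ih => exact ih

theorem RootOf.lt {par : ℕ → ℕ} {n x y : ℕ} (hp : ∀ x < n, par x < n) (h : RootOf par x y)
    (hx : x < n) : y < n := by
  induction h with
  | base => exact hx
  | step _ _ ih => exact ih (hp _ hx)

theorem RootOf.unique {par : ℕ → ℕ} {x y z : ℕ} (h : RootOf par x y) (h' : RootOf par x z) :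
    y = z := by
  induction h with
  | base h =>
    cases h' with
    | base => rfl
    | step h'' => exact absurd h h''
  | step h _ ih =>
    cases h' with
    | base h'' => exact absurd h'' h
    | step _ h'' => exact ih h''

/-- A walk that starts in a closed set without fixed points stays there forever. This is how loops
are turned into the absence of roots. -/
theorem RootOf.notMem_of_closed {par : ℕ → ℕ} {x y : ℕ} {D : Set ℕ}
    (hD : ∀ x ∈ D, par x ≠ x ∧ par x ∈ D) (h : RootOf par x y) : x ∉ D := by
  induction h with
  | base h => exact fun hx => (hD _ hx).1 h
  | step _ _ ih => exact fun hx => ih (hD _ hx).2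

/-- Removing references from a forest preserves the existence of roots. -/
theorem RootOf.exists_of_le {par par' : ℕ → ℕ} {x y : ℕ} (hle : ∀ x, par x = x ∨ par' x = par x)
    (h : RootOf par' x y) : ∃ z, RootOf par x z := by
  induction h with
  | @base x h =>
    rcases hle x with h' | h'
    · exact ⟨x, .base h'⟩
    · exact ⟨x, .base (h' ▸ h)⟩
  | @step x y h _ ih =>
    rcases hle x with h' | h'
    · exact ⟨x, .base h'⟩
    · obtain ⟨z, hz⟩ := ih
      rw [h'] at hz h
      exact ⟨z, .step h hz⟩

theorem exists_rootOf_iff_iterate {par : ℕ → ℕ} {x : ℕ} :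
    (∃ y, RootOf par x y) ↔ ∃ k, par (par^[k] x) = par^[k] x := by
  constructor
  · rintro ⟨y, h⟩
    induction h with
    | base h => exact ⟨0, h⟩
    | step _ _ ih =>
      obtain ⟨k, hk⟩ := ih
      exact ⟨k + 1, hk⟩
  · rintro ⟨k, hk⟩
    induction k generalizing x with
    | zero => exact ⟨x, .base hk⟩
    | succ k ih =>
      by_cases hx : par x = x
      · exact ⟨x, .base hx⟩
      · obtain ⟨y, hy⟩ := ih hk
        exact ⟨y, .step hx hy⟩

theorem iterate_fixed_mono {par : ℕ → ℕ} {x j k : ℕ} (hjk : j ≤ k)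
    (h : par (par^[j] x) = par^[j] x) : par (par^[k] x) = par^[k] x := by
  induction hjk with
  | refl => exact h
  | step _ ih => rw [Function.iterate_succ_apply', ih, ih]

/-- On `n` positions a root is reached after at most `n` references, or never. -/
theorem exists_rootOf_iff_iterate_card {par : ℕ → ℕ} {n x : ℕ} (hp : ∀ x < n, par x < n)
    (hx : x < n) : (∃ y, RootOf par x y) ↔ par (par^[n] x) = par^[n] x := by
  rw [exists_rootOf_iff_iterate]
  refine ⟨fun h => ?_, fun h => ⟨n, h⟩⟩
  classical
  have hspec := Nat.find_spec h
  refine iterate_fixed_mono ?_ hspec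
  by_contra! hlt
  have hmaps : ∀ i, par^[i] x < n := fun i => by
    induction i with
    | zero => exact hx
    | succ i ih => rw [Function.iterate_succ_apply']; exact hp _ ih
  obtain ⟨i, hi, j, hj, hne, heq⟩ := Finset.exists_ne_map_eq_of_card_lt_of_maps_to
    (s := Finset.range (Nat.find h)) (t := Finset.range n) (by simpa using hlt)
    (f := fun i => par^[i] x) (fun i _ => by simpa using hmaps i)
  -- A repetition at times `i < j` before the first fixed time would allow the walk to skip `j - i`
  -- steps and be at the fixed point earlier, against minimality.
  have key : ∀ i j, i < j → j < Nat.find h → par^[i] x = par^[j] x → False := by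
    intro i j hij hj heq
    refine Nat.find_min h (m := Nat.find h - j + i) (by omega) ?_
    rw [Function.iterate_add_apply, heq, ← Function.iterate_add_apply,
      Nat.sub_add_cancel hj.le]
    exact hspec
  simp only [Finset.mem_range] at hi hj
  rcases lt_or_gt_of_ne hne with h' | h'
  · exact key i j h' hj heq
  · exact key j i h' hi heq.symm

/-! ### Acyclicity after contraction of the old trees -/

/-- Following `g` inside the interval `[s, p)` from `y`, one leaves the interval. -/
inductive Exits (s p : ℕ) (g : ℕ → ℕ) : ℕ → Prop
  | out {y} : y < s ∨ p ≤ y → Exits s p g y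
  | step {y} : s ≤ y → y < p → Exits s p g (g y) → Exits s p g y

theorem Exits.notMem_of_closed {s p : ℕ} {g : ℕ → ℕ} {y : ℕ} {D : Set ℕ}
    (hD : ∀ y ∈ D, s ≤ y ∧ y < p ∧ g y ∈ D) (h : Exits s p g y) : y ∉ D := by
  induction h with
  | out h => intro hy; have := hD _ hy; omega
  | step _ _ _ ih => exact fun hy => ih (hD _ hy).2.2

/-- The parent function `par` after the references `s + k ↦ t + k`, `k < ℓ`, have been added. -/
def graft (par : ℕ → ℕ) (s t ℓ x : ℕ) : ℕ := if s ≤ x ∧ x < s + ℓ then t + (x - s) else par x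

theorem graft_zero (par : ℕ → ℕ) (s t : ℕ) : graft par s t 0 = par := by
  ext x
  rw [graft, if_neg (by omega)]

theorem graft_succ (par : ℕ → ℕ) (s t ℓ : ℕ) :
    graft par s t (ℓ + 1) = Function.update (graft par s t ℓ) (s + ℓ) (t + ℓ) := by
  ext x
  rw [Function.update_apply]
  unfold graft
  split_ifs <;> omega

/-- The positions from `s` on are roots beforehand, so a shorter graft only omits references. This
is the form that `RootOf.exists_of_le` needs, both for shortening a phrase and for adding its
references one by one. -/
theorem graft_le {par : ℕ → ℕ} {s t j ℓ : ℕ} (hs : ∀ x, s ≤ x → par x = x) (hj : j ≤ ℓ) (x : ℕ) :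
    graft par s t j x = x ∨ graft par s t ℓ x = graft par s t j x := by
  have := hs x
  unfold graft
  split_ifs <;> omega

/-- Contracting every tree to its root, the new references form a forest if and only if all
walks along them leave the interval in which they start. -/
theorem exists_rootOf_graft_iff {par r : ℕ → ℕ} {n s t ℓ : ℕ} (hs : ∀ x, s ≤ x → par x = x)
    (hp : ∀ x < n, par x < n) (hr : ∀ x < n, RootOf par x (r x)) (hts : t ≠ s)
    (hsn : s + ℓ ≤ n) (htn : t + ℓ ≤ n) :
    (∀ x < n, ∃ y, RootOf (graft par s t ℓ) x y) ↔
      ∀ y, s ≤ y → y < s + ℓ → Exits s (s + ℓ) (fun y => r (t + (y - s))) y := by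
  have hrn : ∀ x < n, r x < n := fun x hx => (hr x hx).lt hp hx
  have hin : ∀ x, s ≤ x → x < s + ℓ → graft par s t ℓ x = t + (x - s) := fun x h h' => by
    simp [graft, h, h']
  have hout : ∀ x, ¬ (s ≤ x ∧ x < s + ℓ) → graft par s t ℓ x = par x := fun x h => by
    simp [graft, h]
  constructor
  · intro h
    -- The claim is made about `r x` instead of `x`: an old reference then changes nothing, and a
    -- new one is one step of the contracted walk.
    have key : ∀ x y, RootOf (graft par s t ℓ) x y → x < n →
        Exits s (s + ℓ) (fun y => r (t + (y - s))) (r x) := by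
      intro x y hxy
      induction hxy with
      | @base x hx =>
        intro hxn
        have hx' : ¬ (s ≤ x ∧ x < s + ℓ) := fun h' => by
          rw [hin x h'.1 h'.2] at hx; omega
        rw [hout x hx'] at hx
        rw [(hr x hxn).unique (.base hx)]
        exact .out (by omega)
      | @step x y hx _ ih =>
        intro hxn
        by_cases hx' : s ≤ x ∧ x < s + ℓ
        · rw [(hr x hxn).unique (.base (hs x hx'.1))]
          rw [hin x hx'.1 hx'.2] at ih
          exact .step hx'.1 hx'.2 (ih (by omega))
        · rw [hout x hx'] at ih hx
          rw [(hr x hxn).unique (.step hx (hr _ (hp x hxn)))]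
          exact ih (hp x hxn)
    intro y hy hy'
    obtain ⟨z, hz⟩ := h y (by omega)
    have := key y z hz (by omega)
    rwa [(hr y (by omega)).unique (.base (hs y hy))] at this
  · intro h
    -- Non-roots of the old forest lie outside the interval, so paths to old roots survive the
    -- graft.
    have lift : ∀ x y z, RootOf par x y → RootOf (graft par s t ℓ) y z →
        RootOf (graft par s t ℓ) x z := by
      intro x y z hxy hz
      induction hxy with
      | base => exact hz
      | @step x y hx _ ih =>
        have : ¬ (s ≤ x ∧ x < s + ℓ) := fun h' => hx (hs x h'.1)
        rw [← hout x this] at hx ih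
        exact .step hx (ih hz)
    have key : ∀ y, Exits s (s + ℓ) (fun y => r (t + (y - s))) y → par y = y → y < n →
        ∃ z, RootOf (graft par s t ℓ) y z := by
      intro y hy
      induction hy with
      | @out y hy => exact fun hf _ => ⟨y, .base (by rw [hout y (by omega), hf])⟩
      | @step y h₁ h₂ _ ih =>
        intro _ _
        have hroot := hr (t + (y - s)) (by omega)
        obtain ⟨z, hz⟩ := ih hroot.fixed (hrn _ (by omega))
        refine ⟨z, .step (by rw [hin y h₁ h₂]; omega) ?_⟩
        rw [hin y h₁ h₂]
        exact lift _ _ _ hroot hz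
    intro x hx
    have hy : Exits s (s + ℓ) (fun y => r (t + (y - s))) (r x) := by
      by_cases h' : s ≤ r x ∧ r x < s + ℓ
      · exact h _ h'.1 h'.2
      · exact .out (by omega)
    obtain ⟨z, hz⟩ := key (r x) hy (hr x hx).fixed (hrn x hx)
    exact ⟨z, lift _ _ _ (hr x hx) hz⟩

/-- The roots after one reference `a ↦ b` from a root `a` has been added. -/
theorem rootOf_update {par r : ℕ → ℕ} {n a b : ℕ} (ha : par a = a) (hab : b ≠ a) (hb : b < n)
    (hr : ∀ x < n, RootOf par x (r x)) (hz : ∃ z, RootOf (Function.update par a b) a z) :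
    ∀ x < n, RootOf (Function.update par a b) x (if r x = a then r b else r x) := by
  have lift : ∀ x y z, RootOf par x y → RootOf (Function.update par a b) y z →
      RootOf (Function.update par a b) x z := by
    intro x y z hxy hz
    induction hxy with
    | base => exact hz
    | @step x y hx _ ih =>
      have hxa : x ≠ a := fun h => hx (h ▸ ha)
      rw [← Function.update_of_ne hxa b par] at hx ih
      exact .step hx (ih hz)
  -- If the root of `b` were `a`, the old tree of `a` would be closed under the new parent function
  -- and contain no fixed point, so `a` would have no root.
  have hrb : r b ≠ a := by
    intro hrb
    obtain ⟨z, hz⟩ := hz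
    refine hz.notMem_of_closed (D := {x | RootOf par x a}) (fun x hx => ?_) (.base ha)
    by_cases hxa : x = a
    · subst hxa
      rw [Function.update_self]
      exact ⟨hab, by simpa [hrb] using hr b hb⟩
    · rw [Function.update_of_ne hxa]
      cases hx with
      | base => exact absurd rfl hxa
      | step h h' => exact ⟨h, h'⟩
  have hfix : ∀ y, par y = y → y ≠ a → RootOf (Function.update par a b) y y := fun y hy hya =>
    .base (by rw [Function.update_of_ne hya, hy])
  intro x hx
  split_ifs with h
  · refine lift x a _ (h ▸ hr x hx) (.step (by rwa [Function.update_self]) ?_)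
    rw [Function.update_self]
    exact lift _ _ _ (hr b hb) (hfix _ (hr b hb).fixed hrb)
  · exact lift _ _ _ (hr x hx) (hfix _ (hr x hx).fixed h)

/-! ### The reference forest of a sequence of phrases -/

/-- The position from which `x` is copied; positions on character phrases and positions on no phrase
are their own parents. -/
def parent (B : List Phrase) (x : ℕ) : ℕ :=
  match refFrom 0 B x with
  | .inl y => y
  | .inr _ => x

theorem totalLength_append (P Q : List Phrase) :
    totalLength (P ++ Q) = totalLength P + totalLength Q := by
  simp [totalLength]

theorem totalLength_cons (f : Phrase) (P : List Phrase) :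
    totalLength (f :: P) = f.length + totalLength P := by
  simp [totalLength]

theorem refFrom_append (P Q : List Phrase) {s x : ℕ} (hx : s ≤ x) :
    refFrom s (P ++ Q) x =
      if x < s + totalLength P then refFrom s P x else refFrom (s + totalLength P) Q x := by
  induction P generalizing s with
  | nil => simp [totalLength, hx]
  | cons f P ih =>
    rw [totalLength_cons]
    cases f with
    | char c =>
      simp only [List.cons_append, refFrom, Phrase.length, ← Nat.add_assoc]
      by_cases h : x < s + 1
      · rw [if_pos h, if_pos (by omega), if_pos h]
      · rw [if_neg h, if_neg h, ih (by omega)]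
    | target t ℓ =>
      simp only [List.cons_append, refFrom, Phrase.length, ← Nat.add_assoc]
      by_cases h : x < s + ℓ
      · rw [if_pos h, if_pos (by omega), if_pos h]
      · rw [if_neg h, if_neg h, ih (by omega)]

theorem refFrom_of_totalLength_le (P : List Phrase) {s x : ℕ} (hx : s + totalLength P ≤ x) :
    refFrom s P x = .inl x := by
  have := refFrom_append P [] (s := s) (x := x) (by omega)
  rwa [List.append_nil, if_neg (by omega)] at this

theorem parent_append (P Q : List Phrase) (x : ℕ) : parent (P ++ Q) x =
    if x < totalLength P then parent P x else
      match refFrom (totalLength P) Q x with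
      | .inl y => y
      | .inr _ => x := by
  unfold parent
  rw [refFrom_append P Q (Nat.zero_le x), Nat.zero_add]
  split_ifs <;> rfl

theorem parent_of_totalLength_le {P : List Phrase} {x : ℕ} (hx : totalLength P ≤ x) :
    parent P x = x := by
  simp [parent, refFrom_of_totalLength_le P (s := 0) (by omega : 0 + totalLength P ≤ x)]

theorem refFrom_map_char {l : List ℕ} {s x y : ℕ} (h : refFrom s (l.map Phrase.char) x = .inl y) :
    y = x := by
  induction l generalizing s with
  | nil => simpa [refFrom, eq_comm] using h
  | cons c l ih =>
    simp only [List.map_cons, refFrom] at h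
    split_ifs at h
    exact ih h

/-- Positions on characters and positions on no phrase are both their own parents. Thus the validity
of a partial sequence can be read off without completing it. -/
theorem parent_append_map_char (P : List Phrase) (l : List ℕ) :
    parent (P ++ l.map Phrase.char) = parent P := by
  ext x
  rw [parent_append]
  split_ifs with h
  · rfl
  · rw [parent_of_totalLength_le (by omega)]
    split
    · next y hy => exact refFrom_map_char hy
    · rfl

theorem parent_append_target (P : List Phrase) (t ℓ : ℕ) :
    parent (P ++ [.target t ℓ]) = graft (parent P) (totalLength P) t ℓ := by
  ext x
  rw [parent_append]
  unfold graft
  by_cases h : x < totalLength P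
  · rw [if_pos h, if_neg (by omega)]
  · rw [if_neg h]
    by_cases h' : x < totalLength P + ℓ
    · simp [refFrom, h', Nat.not_lt.1 h]
    · simp [refFrom, h', parent_of_totalLength_le (Nat.not_lt.1 h)]

theorem isPBPFrom_append {T : List ℕ} {P Q : List Phrase} {s : ℕ} :
    IsPBPFrom T s (P ++ Q) ↔ IsPBPFrom T s P ∧ IsPBPFrom T (s + totalLength P) Q := by
  induction P generalizing s with
  | nil => simp [IsPBPFrom, totalLength]
  | cons f P ih =>
    cases f <;> simp [IsPBPFrom, ih, totalLength_cons, Phrase.length, and_assoc, Nat.add_assoc]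

theorem IsPBPFrom.le {T : List ℕ} {P : List Phrase} {s : ℕ} (h : IsPBPFrom T s P)
    (hs : s ≤ T.length) : s + totalLength P ≤ T.length := by
  induction P generalizing s with
  | nil => simpa [totalLength]
  | cons f P ih =>
    rw [totalLength_cons, ← Nat.add_assoc]
    cases f with
    | char c =>
      obtain ⟨h₁, h₂⟩ := h
      have := (List.getElem?_eq_some_iff.1 h₁).1
      exact ih h₂ (Nat.succ_le_of_lt this)
    | target t ℓ => exact ih h.2.2.2.2.2 h.2.2.1

theorem IsPBP.le {T : List ℕ} {P : List Phrase} (h : IsPBP T P) : totalLength P ≤ T.length := by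
  simpa using IsPBPFrom.le h (Nat.zero_le _)

theorem isPBPFrom_map_char (T : List ℕ) (s : ℕ) :
    IsPBPFrom T s ((T.drop s).map Phrase.char) := by
  by_cases h : s < T.length
  · rw [List.drop_eq_getElem_cons h]
    exact ⟨by simp [h], isPBPFrom_map_char T (s + 1)⟩
  · simp [List.drop_eq_nil_of_le (Nat.not_lt.1 h), IsPBPFrom]
termination_by T.length - s

/-- The condition `t ≠ s` shifts every position of a target phrase. Hence a fixed point of `parent`
inside the phrases is on a character phrase, never a reference to itself. -/
theorem IsPBPFrom.ref {T : List ℕ} {P : List Phrase} {s x y : ℕ} (h : IsPBPFrom T s P)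
    (hsx : s ≤ x) (hx : x < s + totalLength P) (hy : refFrom s P x = .inl y) :
    y ≠ x ∧ y < T.length := by
  induction P generalizing s with
  | nil => simp [totalLength] at hx; omega
  | cons f P ih =>
    rw [totalLength_cons, ← Nat.add_assoc] at hx
    cases f with
    | char c =>
      simp only [refFrom] at hy
      split_ifs at hy with h'
      exact ih h.2 (by omega) hx hy
    | target t ℓ =>
      obtain ⟨-, h₁, h₂, h₃, -, h₄⟩ := h
      simp only [refFrom] at hy
      split_ifs at hy with h'
      · obtain rfl : t + (x - s) = y := by simpa using hy
        omega
      · exact ih h₄ (by omega) hx hy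

theorem IsPBP.parent_lt {T : List ℕ} {P : List Phrase} (h : IsPBP T P) {x : ℕ}
    (hx : x < T.length) : parent P x < T.length := by
  by_cases h' : x < totalLength P
  · unfold parent
    split
    · next y hy => exact (IsPBPFrom.ref h (Nat.zero_le x) (by omega) hy).2
    · exact hx
  · rwa [parent_of_totalLength_le (by omega)]

theorem isBP_complete {T : List ℕ} {P : List Phrase} (h : IsPBP T P) : IsBP T (complete T P) := by
  refine ⟨isPBPFrom_append.2 ⟨h, ?_⟩, ?_⟩
  · rw [Nat.zero_add]
    exact isPBPFrom_map_char _ _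
  · have : ∀ l : List ℕ, totalLength (l.map Phrase.char) = l.length := fun l => by
      induction l with
      | nil => rfl
      | cons c l ih => rw [List.map_cons, totalLength_cons, ih, Phrase.length, List.length_cons,
          Nat.add_comm]
    rw [complete, totalLength_append, this, List.length_drop]
    have := h.le
    omega

/-- `iterRef` follows the parent function until a character is reached. -/
theorem IsBP.iterRef {T : List ℕ} {B : List Phrase} (h : IsBP T B) {x : ℕ} (hx : x < T.length)
    (k : ℕ) :
    ((iterRef B k x).isRight ∧ parent B ((parent B)^[k] x) = (parent B)^[k] x) ∨
    (iterRef B k x = .inl ((parent B)^[k + 1] x) ∧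
      parent B ((parent B)^[k] x) ≠ (parent B)^[k] x) := by
  have hlt : ∀ k, (parent B)^[k] x < T.length := fun k => by
    induction k with
    | zero => exact hx
    | succ k ih => rw [Function.iterate_succ_apply']; exact h.1.parent_lt ih
  have one : ∀ y < T.length, ((refFrom 0 B y).isRight ∧ parent B y = y) ∨
      (refFrom 0 B y = .inl (parent B y) ∧ parent B y ≠ y) := by
    intro y hy
    cases hr : refFrom 0 B y with
    | inr c => exact .inl ⟨rfl, by simp [parent, hr]⟩
    | inl z =>
      have hz : parent B y = z := by simp [parent, hr]
      rw [hz]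
      exact .inr ⟨rfl, (IsPBPFrom.ref h.1 (Nat.zero_le y) (by rw [h.2]; omega) hr).1⟩
  induction k with
  | zero => exact one x hx
  | succ k ih =>
    rcases ih with ⟨h₁, h₂⟩ | ⟨h₁, -⟩
    · left
      obtain ⟨c, hc⟩ := Sum.isRight_iff.1 h₁
      exact ⟨by simp [LZRR.iterRef, hc], iterate_fixed_mono (Nat.le_succ k) h₂⟩
    · rw [LZRR.iterRef, h₁, Function.iterate_succ_apply' _ (k + 1)]
      exact one _ (hlt (k + 1))

/-- By the pigeonhole principle `T.length` references suffice to reach a root if one is reached at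
all, so the bounded iteration in `IsValidBP` expresses the existence of roots. -/
theorem isValidPBP_iff {T : List ℕ} {P : List Phrase} :
    IsValidPBP T P ↔ IsPBP T P ∧ ∀ x < T.length, ∃ y, RootOf (parent P) x y := by
  unfold IsValidPBP IsValidBP
  refine and_congr_right fun h => ?_
  have hB := isBP_complete h
  simp only [hB, true_and]
  refine forall₂_congr fun x hx => ?_
  have hpar : parent (complete T P) = parent P := parent_append_map_char _ _
  rw [exists_rootOf_iff_iterate_card (fun x hx => h.parent_lt hx) hx, ← hpar]
  rcases hB.iterRef hx T.length with ⟨h₁, h₂⟩ | ⟨h₁, h₂⟩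
  · simp [h₁, h₂]
  · simp [h₁, h₂]

theorem isValidPBP_nil (T : List ℕ) : IsValidPBP T [] :=
  isValidPBP_iff.2 ⟨trivial, fun x _ => ⟨x, .base rfl⟩⟩

theorem IsValidPBP.isValidBP {T : List ℕ} {P : List Phrase} (h : IsValidPBP T P)
    (hP : totalLength P = T.length) : IsValidBP T P := by
  simpa [complete, hP] using h.2

theorem IsValidPBP.append_char {T : List ℕ} {P : List Phrase} (h : IsValidPBP T P) {c : ℕ}
    (hc : T[totalLength P]? = some c) : IsValidPBP T (P ++ [.char c]) := by
  rw [isValidPBP_iff] at h ⊢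
  refine ⟨isPBPFrom_append.2 ⟨h.1, ?_⟩, ?_⟩
  · simpa [IsPBPFrom] using hc
  · rw [show P ++ [.char c] = P ++ [c].map Phrase.char from rfl, parent_append_map_char]
    exact h.2

/-! ### Target phrases: criterion, monotonicity, maximal length -/

/-- The conditions on a target phrase `⟨t, ℓ⟩` at position `s` that do not concern loops of
references. -/
def Fits (T : List ℕ) (s t ℓ : ℕ) : Prop :=
  1 ≤ ℓ ∧ t ≠ s ∧ s + ℓ ≤ T.length ∧ t + ℓ ≤ T.length ∧ ∀ k < ℓ, T[s + k]? = T[t + k]?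

theorem isValidPBP_append_target {T : List ℕ} {P : List Phrase} (h : IsPBP T P) {t ℓ : ℕ} :
    IsValidPBP T (P ++ [.target t ℓ]) ↔ Fits T (totalLength P) t ℓ ∧
      ∀ x < T.length, ∃ y, RootOf (graft (parent P) (totalLength P) t ℓ) x y := by
  rw [isValidPBP_iff, parent_append_target]
  refine and_congr_left fun _ => ?_
  have h' : IsPBPFrom T 0 P := h
  unfold IsPBP
  simp [isPBPFrom_append, h', IsPBPFrom, Fits]

theorem isValidPBP_append_target_iff_exits {T : List ℕ} {P : List Phrase} (h : IsPBP T P)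
    {r : ℕ → ℕ} (hr : ∀ x < T.length, RootOf (parent P) x (r x)) {t ℓ : ℕ} :
    IsValidPBP T (P ++ [.target t ℓ]) ↔ Fits T (totalLength P) t ℓ ∧
      ∀ y, totalLength P ≤ y → y < totalLength P + ℓ →
        Exits (totalLength P) (totalLength P + ℓ) (fun y => r (t + (y - totalLength P))) y := by
  rw [isValidPBP_append_target h]
  refine and_congr_right fun hf => ?_
  exact exists_rootOf_graft_iff (fun x hx => parent_of_totalLength_le hx)
    (fun x hx => h.parent_lt hx) hr hf.2.1 hf.2.2.1 hf.2.2.2.1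

/-- A shorter phrase adds fewer references to the forest. The two-pointer search rests on this. -/
theorem IsValidPBP.target_mono {T : List ℕ} {P : List Phrase} (h : IsPBP T P) {t ℓ ℓ' : ℕ}
    (hv : IsValidPBP T (P ++ [.target t ℓ])) (h1 : 1 ≤ ℓ') (hl : ℓ' ≤ ℓ) :
    IsValidPBP T (P ++ [.target t ℓ']) := by
  rw [isValidPBP_append_target h] at hv ⊢
  obtain ⟨⟨_, h₂, h₃, h₄, h₅⟩, h₆⟩ := hv
  refine ⟨⟨h1, h₂, by omega, by omega, fun k hk => h₅ k (by omega)⟩, fun x hx => ?_⟩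
  obtain ⟨y, hy⟩ := h₆ x hx
  exact hy.exists_of_le (graft_le (fun x hx => parent_of_totalLength_le hx) hl)

/-- The length `L` of the longest target phrase, or `0` if there is none. -/
def IsMaxTarget (T : List ℕ) (P : List Phrase) (L : ℕ) : Prop :=
  (L = 0 ∨ ∃ t, IsValidPBP T (P ++ [.target t L])) ∧
    ∀ t ℓ, IsValidPBP T (P ++ [.target t ℓ]) → ℓ ≤ L

theorem exists_isMaxTarget {T : List ℕ} {P : List Phrase} (h : IsPBP T P) :
    ∃ L, IsMaxTarget T P L := by
  classical
  refine ⟨Nat.findGreatest (fun ℓ => ∃ t, IsValidPBP T (P ++ [.target t ℓ])) T.length, ?_, ?_⟩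
  · by_contra! hc
    exact hc.2 _ (Nat.findGreatest_of_ne_zero rfl hc.1).choose_spec
  · intro t ℓ hv
    refine Nat.le_findGreatest ?_ ⟨t, hv⟩
    have := ((isValidPBP_append_target h).1 hv).1.2.2.1
    omega

/-- A phrase longer than `L` could be shortened to `L + 1`, so only that length has to be excluded.
-/
theorem isMaxTarget_of_forall_not {T : List ℕ} {P : List Phrase} (h : IsPBP T P) {L : ℕ}
    (hL : L = 0 ∨ ∃ t, IsValidPBP T (P ++ [.target t L]))
    (hn : ∀ t < T.length, ¬ IsValidPBP T (P ++ [.target t (L + 1)])) : IsMaxTarget T P L := by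
  refine ⟨hL, fun t ℓ hv => ?_⟩
  by_contra! hlt
  have hf := ((isValidPBP_append_target h).1 hv).1
  exact hn t (by have := hf.2.2.2.1; omega) (hv.target_mono h (by omega) hlt)

theorem IsMaxTarget.isLP_target {T : List ℕ} {P : List Phrase} {L t : ℕ} (h : IsMaxTarget T P L)
    (hL : L ≠ 0) (hv : IsValidPBP T (P ++ [.target t L])) : IsLP T P (.target t L) := by
  refine ⟨hv, fun f' hf' => ?_, fun h => h.elim⟩
  cases f' with
  | char c => exact Nat.one_le_iff_ne_zero.2 hL
  | target t' ℓ' => exact h.2 t' ℓ' hf'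

theorem IsMaxTarget.isLP_char {T : List ℕ} {P : List Phrase} {c : ℕ} (hP : IsValidPBP T P)
    (h : IsMaxTarget T P 0) (hc : T[totalLength P]? = some c) : IsLP T P (.char c) := by
  have hno : ∀ t ℓ, ¬ IsValidPBP T (P ++ [.target t ℓ]) := fun t ℓ hv => by
    have h₁ := h.2 t ℓ hv
    have h₂ := ((isValidPBP_append_target hP.1).1 hv).1.1
    omega
  refine ⟨hP.append_char hc, fun f' hf' => ?_, fun _ => hno⟩
  cases f' with
  | char c => exact le_rfl
  | target t' ℓ' => exact absurd hf' (hno t' ℓ')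

/-- Already `y = 1` satisfies `k ≤ ack k y`, by `add_lt_ack`. The Ackermann factor of the theorem is
therefore 1. -/
theorem invAck_self (k : ℕ) : invAck k k = 1 := by
  unfold invAck
  rw [Nat.find_eq_iff]
  refine ⟨⟨le_rfl, ?_⟩, fun m hm h => by omega⟩
  have := add_lt_ack k 1
  omega

end LZRR

/-! ### The program -/

namespace LZRR

open WordRAM

/-- A sequence of statements. -/
def block : List Stmt → Stmt
  | [] => .skip
  | s :: l => .seq s (block l)

section Rules

variable {w S : ℕ} {σ : State} {B : ℕ} {Q : State → ℕ → Prop}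

theorem wp_nil (h : Q σ B) : WP w S (block []) σ B Q := wp_skip h

theorem wp_cons {s : Stmt} {l : List Stmt}
    (h : WP w S s σ B fun σ' B' => WP w S (block l) σ' B' Q) : WP w S (block (s :: l)) σ B Q :=
  wp_seq h

end Rules

-- Registers 0 to 4 hold constants during the run; 0 and 1 are also those in which the machine
-- expects the number of phrases and the output address at the end.
local notation "ρn" => 0
local notation "ρout" => 1
local notation "ρone" => 2
local notation "ρzero" => 3
local notation "ρmark" => 4
local notation "ρs" => 5
local notation "ρcnt" => 6
local notation "ρo" => 7
local notation "ρL" => 8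
local notation "ρbest" => 9
local notation "ρt" => 10
local notation "ρlen" => 11
local notation "ρok" => 12
local notation "ρp" => 13
local notation "ρq" => 14
local notation "ρx" => 15
local notation "ρy" => 16
local notation "ρk" => 17
local notation "ρk1" => 18
local notation "ρgo" => 19
local notation "ρa" => 20
local notation "ρv" => 21
local notation "ρu" => 22
local notation "ρi" => 23
local notation "ρe" => 24

/-- Compare the characters at `x` and `y`, and erase the mark of `x`. -/
def compareStep : Stmt := block
  [.load ρu ρx, .load ρv ρy, .ite (.eq ρu ρv) .skip (.const ρok 0),
    .add ρa ρmark ρx, .store ρa ρzero, .add ρx ρx ρone, .add ρy ρy ρone]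

/-- Compare the substrings at `s` and `t` that end before `p` and `p + t - s`, and erase the
marks in `[s, p)`. -/
def compare : Stmt := block
  [.add ρx ρs ρzero, .add ρy ρt ρzero, .loop (.lt ρx ρp) compareStep]

/-- Go from `y` to the root of its reference, unless `y` is outside `[s, p)` or marked. -/
def walkStep : Stmt :=
  .ite (.lt ρy ρs) (.const ρgo 0) <|
    .ite (.lt ρy ρp)
      (block
        [.add ρa ρmark ρy, .load ρu ρa,
          .ite (.eq ρu ρzero)
            -- The order `y - s + t + n` avoids the difference `t - s`, which may be negative.
            (block [.store ρa ρk1, .sub ρa ρy ρs, .add ρa ρa ρt, .add ρa ρa ρn, .load ρy ρa])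
            (block
              [.const ρgo 0,
                -- A position with the mark of the present walk closes a cycle; any other nonzero
                -- mark comes from an earlier walk, which left the interval. Setting `ρe` to `p`
                -- ends the outer loop.
                .ite (.eq ρu ρk1) (block [.const ρok 0, .add ρe ρp ρzero]) .skip])])
      (.const ρgo 0)

/-- Walk from `y`, marking what is visited with `k + 1`. -/
def walk : Stmt := .loop (.lt ρzero ρgo) walkStep

/-- Walk from `k` and go on to `k + 1`, or to `p` if a cycle has been found. -/
def cycleStep : Stmt := block
  [.add ρk1 ρk ρone, .add ρe ρk1 ρzero, .add ρy ρk ρzero, .const ρgo 1, walk, .add ρk ρe ρzero]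

/-- Look for a cycle among the new references. -/
def findCycle : Stmt := block [.add ρk ρs ρzero, .loop (.lt ρk ρp) cycleStep]

/-- Test whether the target phrase `⟨t, len⟩` at `s` is possible. -/
def test : Stmt := block
  [.const ρok 0,
    .ite (.eq ρt ρs) .skip (block
      [.add ρp ρs ρlen, .add ρq ρt ρlen,
        .ite (.lt ρn ρp) .skip (.ite (.lt ρn ρq) .skip (block
          [.const ρok 1, compare, .ite (.eq ρok ρone) findCycle .skip]))])]

/-- Try to improve the longest target phrase with the reference position `t`. -/
def searchStep : Stmt := block
  [.add ρlen ρL ρone, test,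
    -- After a success the same `t` is tried with a greater length. After a failure it is never
    -- needed again, by monotonicity.
    .ite (.eq ρok ρone) (block [.add ρL ρlen ρzero, .add ρbest ρt ρzero]) (.add ρt ρt ρone)]

/-- Find a longest target phrase at `s`. -/
def search : Stmt := block
  [.const ρL 0, .const ρbest 0, .const ρt 0, .loop (.lt ρt ρn) searchStep]

/-- Replace the root of `i` by `v` if it is `s`. -/
def replaceStep : Stmt := block
  [.add ρa ρn ρi, .load ρu ρa, .ite (.eq ρu ρs) (.store ρa ρv) .skip, .add ρi ρi ρone]

/-- Add the reference from `s` to `y` to the forest. -/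
def linkStep : Stmt := block
  [.add ρa ρn ρy, .load ρv ρa, .const ρi 0, .loop (.lt ρi ρn) replaceStep,
    .add ρs ρs ρone, .add ρy ρy ρone]

/-- Add the references of the target phrase `⟨best, L⟩` at `s` to the forest. -/
def link : Stmt := block
  [.add ρe ρs ρL, .add ρy ρbest ρzero, .loop (.lt ρs ρe) linkStep]

/-- Output one phrase. -/
def phraseStep : Stmt := block
  [search,
    .ite (.eq ρL ρzero)
      (block [.load ρu ρs, .store ρo ρu, .add ρo ρo ρone, .store ρo ρzero, .add ρs ρs ρone])
      (block [.store ρo ρbest, .add ρo ρo ρone, .store ρo ρL, link]),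
    .add ρo ρo ρone, .add ρcnt ρcnt ρone]

/-- Make position `i` a root. -/
def initStep : Stmt := block [.add ρa ρn ρi, .store ρa ρi, .add ρi ρi ρone]

/-- The algorithm. The cells `[0, n)` hold the text, `[n, 2 n)` the roots, `[2 n, 3 n)` the marks
and `[3 n, 5 n)` the output. -/
def main : Stmt := block
  [.const ρone 1, .const ρzero 0, .add ρmark ρn ρn, .add ρout ρmark ρn,
    .const ρi 0, .loop (.lt ρi ρn) initStep,
    .const ρs 0, .const ρcnt 0, .add ρo ρout ρzero, .loop (.lt ρs ρn) phraseStep,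
    .add ρn ρcnt ρzero]

/-! ### Verification: comparison of substrings -/

/-- The registers that hold constants. -/
structure Consts (n : ℕ) (σ : State) : Prop where
  n_eq : σ.reg ρn = n
  out_eq : σ.reg ρout = 3 * n
  one_eq : σ.reg ρone = 1
  zero_eq : σ.reg ρzero = 0
  mark_eq : σ.reg ρmark = 2 * n

theorem Consts.of_frame {n : ℕ} {σ σ' : State} (h : Consts n σ) {l : List ℕ}
    (hf : ∀ r ∉ l, σ'.reg r = σ.reg r) (hl : ∀ r < 5, r ∉ l) : Consts n σ' :=
  ⟨by rw [hf _ (hl _ (by omega)), h.n_eq], by rw [hf _ (hl _ (by omega)), h.out_eq],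
    by rw [hf _ (hl _ (by omega)), h.one_eq], by rw [hf _ (hl _ (by omega)), h.zero_eq],
    by rw [hf _ (hl _ (by omega)), h.mark_eq]⟩

/-- The text is not empty, and words are large enough for addresses. -/
structure Fit (w n : ℕ) : Prop where
  pos : 1 ≤ n
  -- No address or sum formed by the program exceeds `5 * n`, so nothing overflows.
  le : 8 * n ≤ 2 ^ w

/-- The invariant of `compare` after `j` comparisons. -/
def CompareInv (n s t ℓ : ℕ) (σ : State) (B j : ℕ) (σ' : State) (B' : ℕ) : Prop :=
  σ'.reg ρx = s + j ∧ σ'.reg ρy = t + j ∧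
  ((σ'.reg ρok = 1 ∧ ∀ k < j, σ.mem (s + k) = σ.mem (t + k)) ∨
    (σ'.reg ρok = 0 ∧ ∃ k < ℓ, σ.mem (s + k) ≠ σ.mem (t + k))) ∧
  (∀ y, s ≤ y → y < s + j → σ'.mem (2 * n + y) = 0) ∧
  (∀ a, a < 2 * n ∨ 3 * n ≤ a → σ'.mem a = σ.mem a) ∧ B ≤ B' + 15 * j + 2

theorem wp_compareStep {w n : ℕ} (hw : Fit w n) {σ σ' : State} {B B' s t ℓ j : ℕ}
    (hc : Consts n σ') (hj : j < ℓ) (hsn : s + ℓ ≤ n) (htn : t + ℓ ≤ n) (hB : 15 * ℓ + 10 ≤ B)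
    (h : CompareInv n s t ℓ σ B j σ' B') :
    WP w (5 * n) compareStep σ' (B' - 2) (CompareInv n s t ℓ σ B (j + 1)) := by
  obtain ⟨h1, h2⟩ := hw
  obtain ⟨c0, c1, c2, c3, c4⟩ := hc
  obtain ⟨hx, hy, hm, hz, hfr, hb⟩ := h
  refine wp_cons (wp_load ⟨by omega, by omega, ?_⟩)
  refine wp_cons (wp_load ⟨by omega, by simp [*]; omega, ?_⟩)
  have e1 : σ'.mem (s + j) = σ.mem (s + j) := hfr _ (by omega)
  have e2 : σ'.mem (t + j) = σ.mem (t + j) := hfr _ (by omega)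
  have rest : ∀ (σ₁ : State) (B₁ : ℕ), B' ≤ B₁ + 8 → σ₁.mem = σ'.mem → Consts n σ₁ →
      σ₁.reg ρx = s + j → σ₁.reg ρy = t + j →
      ((σ₁.reg ρok = 1 ∧ ∀ k < j + 1, σ.mem (s + k) = σ.mem (t + k)) ∨
        (σ₁.reg ρok = 0 ∧ ∃ k < ℓ, σ.mem (s + k) ≠ σ.mem (t + k))) →
      WP w (5 * n) (block [.add ρa ρmark ρx, .store ρa ρzero, .add ρx ρx ρone,
        .add ρy ρy ρone]) σ₁ B₁ (CompareInv n s t ℓ σ B (j + 1)) := by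
    intro σ₁ B₁ hb₁ hmem ⟨f0, f1, f2, f3, f4⟩ hx₁ hy₁ hm₁
    refine wp_cons (wp_add ⟨by omega, by omega, ?_⟩)
    refine wp_cons (wp_store ⟨by omega, by simp [*]; omega, ?_⟩)
    refine wp_cons (wp_add ⟨by omega, by simp [*]; omega, ?_⟩)
    refine wp_cons (wp_add ⟨by omega, by simp [*]; omega, wp_nil ?_⟩)
    refine ⟨by simp [*]; omega, by simp [*]; omega, by simpa using hm₁,
      fun y hy hy' => ?_, fun a ha => ?_, by omega⟩
    · simp only [Function.update_apply, *]
      simp only [Nat.reduceEqDiff, if_false, if_true]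
      split_ifs with hne
      · rfl
      · exact hz y hy (by omega)
    · simp only [Function.update_apply, hmem, hx₁, f4, f3]
      simp only [Nat.reduceEqDiff, if_false, if_true]
      rw [if_neg (by omega)]
      exact hfr a ha
  refine wp_cons (wp_ite (by omega) (fun heq => wp_skip ?_)
    (fun heq => wp_const ⟨by omega, by omega, ?_⟩))
  · simp [Cond.Holds, hx, hy, e1, e2] at heq
    refine rest _ _ (by omega) rfl
      ⟨by simp [*], by simp [*], by simp [*], by simp [*], by simp [*]⟩
      (by simp [*]) (by simp [*]) ?_
    rcases hm with ⟨hm, hm'⟩ | hm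
    · refine .inl ⟨by simpa using hm, fun k hk => ?_⟩
      rcases Nat.lt_succ_iff_lt_or_eq.1 hk with h | rfl
      · exact hm' k h
      · exact heq
    · exact .inr (by simpa using hm)
  · simp [Cond.Holds, hx, hy, e1, e2] at heq
    exact rest _ _ (by omega) rfl ⟨by simp [*], by simp [*], by simp [*], by simp [*], by simp [*]⟩
      (by simp [*]) (by simp [*]) (.inr ⟨by simp, j, by omega, heq⟩)

theorem wp_compare {w n : ℕ} (hw : Fit w n) {σ : State} {B s t ℓ : ℕ} (hc : Consts n σ)
    (hs : σ.reg ρs = s) (ht : σ.reg ρt = t) (hp : σ.reg ρp = s + ℓ) (hsn : s + ℓ ≤ n)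
    (htn : t + ℓ ≤ n) (hok : σ.reg ρok = 1) (hB : 15 * ℓ + 10 ≤ B) :
    WP w (5 * n) compare σ B fun σ' B' =>
      ((σ'.reg ρok = 1 ∧ ∀ k < ℓ, σ.mem (s + k) = σ.mem (t + k)) ∨
        (σ'.reg ρok = 0 ∧ ∃ k < ℓ, σ.mem (s + k) ≠ σ.mem (t + k))) ∧
      (∀ y, s ≤ y → y < s + ℓ → σ'.mem (2 * n + y) = 0) ∧
      (∀ a, a < 2 * n ∨ 3 * n ≤ a → σ'.mem a = σ.mem a) ∧ B ≤ B' + 15 * ℓ + 10 := by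
  obtain ⟨h1, h2⟩ := id hw
  obtain ⟨c0, c1, c2, c3, c4⟩ := id hc
  refine wp_cons (wp_add ⟨by omega, by omega, ?_⟩)
  refine wp_cons (wp_add ⟨by omega, by simp [*]; omega, ?_⟩)
  refine wp_cons (wp_loop (fun σ' B' => ∃ j ≤ ℓ, CompareInv n s t ℓ σ B j σ' B') ?_ ?_)
  · exact ⟨0, by omega, by simp [*], by simp [*], .inl ⟨by simp [*], by omega⟩, by omega,
      fun _ _ => rfl, by omega⟩
  · rintro σ' B' hf ⟨j, hj, hI⟩
    have hc' := hc.of_frame (σ' := σ') (l := ρx :: ρy :: compareStep.writes) (fun r hr => by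
      rw [hf r (by simp_all)]
      simp_all) (by decide)
    have hp' : σ'.reg ρp = s + ℓ := by rw [hf _ (by decide)]; simp [hp]
    have hb := hI.2.2.2.2.2
    refine ⟨by omega, fun hlt => ?_, fun hlt => wp_nil ?_⟩
    · simp only [Cond.Holds, hI.1, hp'] at hlt
      exact (wp_compareStep hw hc' (by omega) hsn htn hB hI).conseq
        fun σ' B' _ h => ⟨j + 1, by omega, h⟩
    · simp only [Cond.Holds, hI.1, hp'] at hlt
      obtain rfl : j = ℓ := by omega
      obtain ⟨-, -, hm, hz, hfr, -⟩ := hI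
      exact ⟨hm, hz, hfr, by omega⟩

/-! ### Verification: cycle detection by marked walks -/

/-- The number of unmarked positions in `[s, p)`; the marks are in the cells from `m` on. -/
def unmarked (m s p : ℕ) (mem : ℕ → ℕ) : ℕ :=
  ((Finset.Ico s p).filter fun z => mem (m + z) = 0).card

theorem unmarked_le (m s p : ℕ) (mem : ℕ → ℕ) : unmarked m s p mem ≤ p - s := by
  simpa [unmarked] using Finset.card_filter_le (Finset.Ico s p) fun z => mem (m + z) = 0

/-- The number of unmarked positions is the potential of the amortised analysis: a walk step that
goes on marks a fresh position and is paid by it. -/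
theorem unmarked_update {m s p y v : ℕ} {mem : ℕ → ℕ} (hs : s ≤ y) (hp : y < p) (hv : v ≠ 0)
    (hy : mem (m + y) = 0) :
    unmarked m s p (Function.update mem (m + y) v) + 1 = unmarked m s p mem := by
  unfold unmarked
  rw [← Finset.card_erase_add_one (s := (Finset.Ico s p).filter fun z => mem (m + z) = 0) (a := y)
    (by simp [hs, hp, hy])]
  congr 2
  ext z
  simp only [Finset.mem_filter, Finset.mem_erase, Function.update_apply, Nat.add_left_cancel_iff]
  split_ifs with h <;> simp [h, hv]

/-- The invariant of `walk`, started at `k` in state `σ` with `B` credits. -/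
def WalkInv (n s p k : ℕ) (g : ℕ → ℕ) (σ : State) (B : ℕ) (σ' : State) (B' : ℕ) : Prop :=
  (∀ a, a < 2 * n ∨ 3 * n ≤ a → σ'.mem a = σ.mem a) ∧
  (∀ z, s ≤ z → z < p → σ'.mem (2 * n + z) = σ.mem (2 * n + z) ∨
    (σ.mem (2 * n + z) = 0 ∧ σ'.mem (2 * n + z) = k + 1)) ∧
  -- While the walk goes on, the positions marked `k + 1` form a trail that ends at the current `y`:
  -- they lead to `y` or to each other, and leave the interval if `y` does. Each of them has paid 16
  -- credits.
  ((σ'.reg ρgo = 1 ∧ σ'.reg ρok = 1 ∧ σ'.reg ρe = k + 1 ∧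
      (∀ z, s ≤ z → z < p → σ'.mem (2 * n + z) = k + 1 →
        (g z = σ'.reg ρy ∨ (s ≤ g z ∧ g z < p ∧ σ'.mem (2 * n + g z) = k + 1)) ∧
        (Exits s p g (σ'.reg ρy) → Exits s p g z)) ∧
      (σ'.reg ρy = k ∨ σ'.mem (2 * n + k) ≠ 0) ∧
      B + 16 * unmarked (2 * n) s p σ'.mem ≤ B' + 16 * unmarked (2 * n) s p σ.mem) ∨
    -- The additional 16 credits pay for the last step, which marks nothing.
    (σ'.reg ρgo = 0 ∧ B + 16 * unmarked (2 * n) s p σ'.mem ≤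
        B' + 16 * unmarked (2 * n) s p σ.mem + 16 ∧
      ((σ'.reg ρok = 1 ∧ σ'.reg ρe = k + 1 ∧ σ'.mem (2 * n + k) ≠ 0 ∧
        ∀ z, s ≤ z → z < p → σ'.mem (2 * n + z) = k + 1 → Exits s p g z) ∨
      (σ'.reg ρok = 0 ∧ σ'.reg ρe = p ∧ ∃ y, s ≤ y ∧ y < p ∧ ¬ Exits s p g y))))

/-- By `hm`, the marks present before the walk are at most `k`, so that `k + 1` is fresh, and they
lie only on positions known to leave the interval. -/
theorem wp_walkStep {w n : ℕ} (hw : Fit w n) {σ σ' : State} {B B' s t p k : ℕ} {g : ℕ → ℕ}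
    (hc : Consts n σ') (hs : σ'.reg ρs = s) (ht : σ'.reg ρt = t) (hp : σ'.reg ρp = p)
    (hk1 : σ'.reg ρk1 = k + 1) (hsk : s ≤ k) (hkp : k < p) (hpn : p ≤ n) (htn : t + (p - s) ≤ n)
    (hg : ∀ y, s ≤ y → y < p → σ.mem (n + (t + (y - s))) = g y)
    (hm : ∀ z, s ≤ z → z < p → σ.mem (2 * n + z) ≤ k ∧
      (σ.mem (2 * n + z) ≠ 0 → Exits s p g z))
    (hB : 16 * unmarked (2 * n) s p σ.mem + 20 ≤ B) (hgo : 0 < σ'.reg ρgo)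
    (h : WalkInv n s p k g σ B σ' B') :
    WP w (5 * n) walkStep σ' (B' - 2) (WalkInv n s p k g σ B) := by
  obtain ⟨h1, h2⟩ := hw
  obtain ⟨c0, c1, c2, c3, c4⟩ := hc
  obtain ⟨hfr, hmk, ⟨hgo1, hok, he, hpath, hyk, hb⟩ | ⟨hgo', -⟩⟩ := h
  swap
  · omega
  have hexit : Exits s p g (σ'.reg ρy) → σ'.mem (2 * n + k) ≠ 0 →
      ∀ (reg : ℕ → ℕ) (B₁ : ℕ), reg ρgo = 0 → reg ρok = 1 → reg ρe = k + 1 → B' ≤ B₁ + 16 →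
      WalkInv n s p k g σ B ⟨reg, σ'.mem⟩ B₁ := by
    intro hex hk0 reg B₁ h₁ h₂ h₃ h₄
    exact ⟨hfr, hmk, .inr ⟨h₁, by simp only; omega, .inl ⟨h₂, h₃, hk0, fun z hz hz' hzk =>
      (hpath z hz hz' hzk).2 hex⟩⟩⟩
  have hout : σ'.reg ρy < s ∨ p ≤ σ'.reg ρy → σ'.mem (2 * n + k) ≠ 0 := fun ho =>
    hyk.resolve_left (by omega)
  refine wp_ite (by omega) (fun hlt => wp_const ⟨by omega, by omega, ?_⟩) (fun hlt => ?_)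
  · simp only [Cond.Holds, hs] at hlt
    exact hexit (.out (.inl hlt)) (hout (.inl hlt)) _ _ (by simp) (by simp [*]) (by simp [*])
      (by omega)
  simp only [Cond.Holds, hs] at hlt
  refine wp_ite (by omega) (fun hlt' => ?_) (fun hlt' => wp_const ⟨by omega, by omega, ?_⟩)
  swap
  · simp only [Cond.Holds, hp] at hlt'
    exact hexit (.out (.inr (by omega))) (hout (.inr (by omega))) _ _ (by simp) (by simp [*])
      (by simp [*]) (by omega)
  simp only [Cond.Holds, hp] at hlt'
  obtain ⟨y, hy⟩ : ∃ y, σ'.reg ρy = y := ⟨_, rfl⟩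
  rw [hy] at hlt hlt' hpath hyk
  refine wp_cons (wp_add ⟨by omega, by omega, ?_⟩)
  refine wp_cons (wp_load ⟨by omega, by simp [*]; omega, ?_⟩)
  refine wp_cons (wp_ite (by omega) (fun h0 => ?_) (fun h0 => ?_))
  · simp [Cond.Holds, c3, c4, hy] at h0
    refine wp_cons (wp_store ⟨by omega, by simp [*]; omega, ?_⟩)
    refine wp_cons (wp_sub ⟨by omega, by simp [*]; omega, by simp [*]; omega, ?_⟩)
    refine wp_cons (wp_add ⟨by omega, by simp [*]; omega, ?_⟩)
    refine wp_cons (wp_add ⟨by omega, by simp [*]; omega, ?_⟩)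
    refine wp_cons (wp_load ⟨by omega, by simp [*]; omega, wp_nil (wp_nil ?_)⟩)
    have hgy : σ'.mem (y - s + t + n) = g y := by
      rw [hfr _ (by omega), ← hg y (by omega) hlt']
      congr 1
      omega
    have hun := unmarked_update (m := 2 * n) (s := s) (y := y) (mem := σ'.mem) (v := k + 1) (by omega) hlt'
      (by omega) h0
    simp only [WalkInv, Function.update_apply, c4, hy, hk1, hs, ht, c0]
    simp only [Nat.reduceEqDiff, if_false, if_true]
    rw [if_neg (by omega), hgy]
    refine ⟨fun a ha => ?_, fun z hz hz' => ?_, .inl ⟨hgo1, hok, he, fun z hz hz' hzk => ?_, ?_, by omega⟩⟩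
    · rw [if_neg (by omega), hfr a ha]
    · by_cases hzy : z = y
      · subst hzy
        have := hmk z hz hz'
        exact .inr ⟨by omega, by simp⟩
      · rw [if_neg (by omega)]
        exact hmk z hz hz'
    · by_cases hzy : z = y
      · subst hzy
        exact ⟨.inl rfl, fun hex => .step hz hz' hex⟩
      · rw [if_neg (by omega)] at hzk
        obtain ⟨h₁, h₂⟩ := hpath z hz hz' hzk
        refine ⟨.inr ?_, fun hex => h₂ (.step (by omega) hlt' hex)⟩
        rcases h₁ with h₁ | ⟨h₁, h₁', h₁''⟩
        · rw [h₁]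
          exact ⟨by omega, hlt', by simp⟩
        · exact ⟨h₁, h₁', by split_ifs <;> simp [h₁'']⟩
    · right
      split_ifs with hky
      · omega
      · exact hyk.resolve_left (by omega)
  · simp [Cond.Holds, c3, c4, hy] at h0
    refine wp_cons (wp_const ⟨by omega, by omega, ?_⟩)
    refine wp_cons (wp_ite (by omega) (fun hk => ?_) (fun hk => wp_skip (wp_nil (wp_nil ?_))))
    · simp [Cond.Holds, hk1, c4, hy] at hk
      refine wp_cons (wp_const ⟨by omega, by omega, ?_⟩)
      refine wp_cons (wp_add ⟨by omega, by simp [*]; omega, wp_nil (wp_nil (wp_nil ?_))⟩)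
      refine ⟨hfr, hmk, .inr ⟨by simp, by simp only; omega, .inr ⟨by simp, by simp [*], y,
        by omega, hlt', fun hex => ?_⟩⟩⟩
      -- Once the current position carries the mark `k + 1`, the trail is closed under `g` and lies
      -- in `[s, p)`, so none of its positions leaves.
      refine hex.notMem_of_closed (D := {z | s ≤ z ∧ z < p ∧ σ'.mem (2 * n + z) = k + 1})
        (fun z hz => ⟨hz.1, hz.2.1, ?_⟩) ⟨by omega, hlt', hk⟩
      rcases (hpath z hz.1 hz.2.1 hz.2.2).1 with h | h
      · rw [h]
        exact ⟨by omega, hlt', hk⟩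
      · exact h
    · simp [Cond.Holds, hk1, c4, hy] at hk
      have hym := hmk y (by omega) hlt'
      have hye := hm y (by omega) hlt'
      -- The mark of `y` is older than this walk, so `y` leaves the interval, and with it the whole
      -- trail.
      refine hexit (by rw [hy]; exact hye.2 (by omega)) ?_ _ _ (by simp) (by simp [*])
        (by simp [*]) (by omega)
      rcases hyk with rfl | h
      · exact h0
      · exact h

theorem wp_walk {w n : ℕ} (hw : Fit w n) {σ : State} {B s t p k : ℕ} {g : ℕ → ℕ}
    (hc : Consts n σ) (hs : σ.reg ρs = s) (ht : σ.reg ρt = t) (hp : σ.reg ρp = p)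
    (hk1 : σ.reg ρk1 = k + 1) (hsk : s ≤ k) (hkp : k < p) (hpn : p ≤ n) (htn : t + (p - s) ≤ n)
    (hg : ∀ y, s ≤ y → y < p → σ.mem (n + (t + (y - s))) = g y)
    (hm : ∀ z, s ≤ z → z < p → σ.mem (2 * n + z) ≤ k ∧
      (σ.mem (2 * n + z) ≠ 0 → Exits s p g z))
    (hy : σ.reg ρy = k) (hgo : σ.reg ρgo = 1) (hok : σ.reg ρok = 1) (he : σ.reg ρe = k + 1)
    (hB : 16 * unmarked (2 * n) s p σ.mem + 20 ≤ B) :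
    WP w (5 * n) walk σ B fun σ' B' =>
      (∀ a, a < 2 * n ∨ 3 * n ≤ a → σ'.mem a = σ.mem a) ∧
      B + 16 * unmarked (2 * n) s p σ'.mem ≤ B' + 16 * unmarked (2 * n) s p σ.mem + 18 ∧
      ((σ'.reg ρok = 1 ∧ σ'.reg ρe = k + 1 ∧ σ'.mem (2 * n + k) ≠ 0 ∧
        (∀ z, s ≤ z → z < p → σ'.mem (2 * n + z) ≤ k + 1 ∧
          (σ'.mem (2 * n + z) ≠ 0 → Exits s p g z) ∧
          (σ.mem (2 * n + z) ≠ 0 → σ'.mem (2 * n + z) ≠ 0))) ∨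
      (σ'.reg ρok = 0 ∧ σ'.reg ρe = p ∧ ∃ y, s ≤ y ∧ y < p ∧ ¬ Exits s p g y)) := by
  refine wp_loop (WalkInv n s p k g σ B) ?_ ?_
  · refine ⟨fun _ _ => rfl, fun _ _ _ => .inl rfl, .inl ⟨hgo, hok, he, fun z hz hz' hzk => ?_,
      .inl hy, le_rfl⟩⟩
    have := (hm z hz hz').1
    omega
  · intro σ' B' hf hI
    have hc' := hc.of_frame hf (by decide)
    refine ⟨?_, fun hgo' => ?_, fun hgo' => ?_⟩
    · rcases hI.2.2 with h | h <;> omega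
    · simp only [Cond.Holds, hc'.zero_eq] at hgo'
      exact wp_walkStep hw hc' (by rw [hf _ (by decide), hs]) (by rw [hf _ (by decide), ht])
        (by rw [hf _ (by decide), hp]) (by rw [hf _ (by decide), hk1]) hsk hkp hpn htn hg hm hB hgo'
        hI
    · simp only [Cond.Holds, hc'.zero_eq] at hgo'
      obtain ⟨hfr, hmk, h | ⟨-, hb, h⟩⟩ := hI
      · omega
      refine ⟨hfr, by omega, h.imp_left fun ⟨h₁, h₂, h₃, h₄⟩ => ⟨h₁, h₂, h₃, fun z hz hz' => ?_⟩⟩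
      have hz₁ := hmk z hz hz'
      have hz₂ := hm z hz hz'
      refine ⟨by omega, fun h0 => ?_, by omega⟩
      rcases hz₁ with hz₁ | hz₁
      · exact hz₂.2 (by omega)
      · exact h₄ z hz hz' hz₁.2

/-- The invariant of `findCycle`. -/
def CycleInv (n s p : ℕ) (g : ℕ → ℕ) (σ : State) (B k : ℕ) (σ' : State) (B' : ℕ) : Prop :=
  σ'.reg ρk = k ∧ (∀ a, a < 2 * n ∨ 3 * n ≤ a → σ'.mem a = σ.mem a) ∧
  -- Every position of the interval pays 16 credits for being marked and 30 for being a starting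
  -- point; this gives the 46 in `wp_findCycle`.
  B + 16 * unmarked (2 * n) s p σ'.mem ≤ B' + 16 * (p - s) + 30 * (k - s) + 1 ∧
  ((σ'.reg ρok = 1 ∧ (∀ z, s ≤ z → z < p → σ'.mem (2 * n + z) ≤ k ∧
      (σ'.mem (2 * n + z) ≠ 0 → Exits s p g z) ∧ (z < k → σ'.mem (2 * n + z) ≠ 0))) ∨
    (σ'.reg ρok = 0 ∧ k = p ∧ ∃ y, s ≤ y ∧ y < p ∧ ¬ Exits s p g y))

theorem wp_cycleStep {w n : ℕ} (hw : Fit w n) {σ σ' : State} {B B' s t p k : ℕ} {g : ℕ → ℕ}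
    (hc : Consts n σ') (hs : σ'.reg ρs = s) (ht : σ'.reg ρt = t) (hp : σ'.reg ρp = p)
    (hsk : s ≤ k) (hkp : k < p) (hpn : p ≤ n) (htn : t + (p - s) ≤ n)
    (hg : ∀ y, s ≤ y → y < p → σ.mem (n + (t + (y - s))) = g y)
    (hB : 46 * (p - s) + 10 ≤ B) (h : CycleInv n s p g σ B k σ' B') :
    WP w (5 * n) cycleStep σ' (B' - 2) fun σ' B' =>
      ∃ k, s ≤ k ∧ k ≤ p ∧ CycleInv n s p g σ B k σ' B' := by
  obtain ⟨h1, h2⟩ := id hw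
  obtain ⟨c0, c1, c2, c3, c4⟩ := id hc
  obtain ⟨hk, hfr, hb, ⟨hok, hm⟩ | h⟩ := h
  swap
  · omega
  refine wp_cons (wp_add ⟨by omega, by omega, ?_⟩)
  refine wp_cons (wp_add ⟨by omega, by simp [*]; omega, ?_⟩)
  refine wp_cons (wp_add ⟨by omega, by simp [*]; omega, ?_⟩)
  refine wp_cons (wp_const ⟨by omega, by omega, ?_⟩)
  refine wp_cons (WP.conseq (wp_walk hw (s := s) (t := t) (p := p) (k := k) (g := g)
    ⟨by simp [*], by simp [*], by simp [*], by simp [*], by simp [*]⟩ (by simp [*]) (by simp [*])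
    (by simp [*]) (by simp [*]) hsk hkp hpn htn (fun y hy hy' => ?_)
    (fun z hz hz' => ⟨(hm z hz hz').1, (hm z hz hz').2.1⟩)
    (by simp [*]) (by simp [*]) (by simp [*]) (by simp [*]) (by simp only; omega)) ?_)
  · rw [← hg y hy hy']
    exact hfr _ (by omega)
  · rintro σ₁ B₁ hf ⟨hfr₁, hb₁, hcase⟩
    have hc₁ := hc.of_frame (σ' := σ₁) (l := cycleStep.writes) (fun r hr => by
      rw [hf r (by simp_all [cycleStep, block, Stmt.writes])]
      simp_all [cycleStep, block, Stmt.writes]) (by decide)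
    obtain ⟨d0, d1, d2, d3, d4⟩ := id hc₁
    have he : σ₁.reg ρe ≤ n := by omega
    refine wp_cons (wp_add ⟨by simp only at hb₁; omega, by omega, wp_nil ?_⟩)
    simp only at hb₁ hfr₁
    rcases hcase with ⟨g₁, g₂, g₃, g₄⟩ | ⟨g₁, g₂, g₃⟩
    · refine ⟨k + 1, by omega, by omega, by simp [*], fun a ha => ?_, ?_, .inl ⟨by simp [*],
        fun z hz hz' => ⟨(g₄ z hz hz').1, (g₄ z hz hz').2.1, fun hzk => ?_⟩⟩⟩
      · rw [hfr₁ a ha, hfr a ha]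
      · simp only
        omega
      · rcases Nat.lt_succ_iff_lt_or_eq.1 hzk with h | rfl
        · exact (g₄ z hz hz').2.2 ((hm z hz hz').2.2 h)
        · exact g₃
    · refine ⟨p, by omega, le_rfl, by simp [*], fun a ha => ?_, ?_, .inr ⟨by simp [*], rfl, g₃⟩⟩
      · rw [hfr₁ a ha, hfr a ha]
      · simp only
        omega

theorem wp_findCycle {w n : ℕ} (hw : Fit w n) {σ : State} {B s t p : ℕ} {g : ℕ → ℕ}
    (hc : Consts n σ) (hs : σ.reg ρs = s) (ht : σ.reg ρt = t) (hp : σ.reg ρp = p)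
    (hsp : s ≤ p) (hpn : p ≤ n) (htn : t + (p - s) ≤ n)
    (hg : ∀ y, s ≤ y → y < p → σ.mem (n + (t + (y - s))) = g y)
    (hm : ∀ z, s ≤ z → z < p → σ.mem (2 * n + z) = 0) (hok : σ.reg ρok = 1)
    (hB : 46 * (p - s) + 10 ≤ B) :
    WP w (5 * n) findCycle σ B fun σ' B' =>
      (∀ a, a < 2 * n ∨ 3 * n ≤ a → σ'.mem a = σ.mem a) ∧ B ≤ B' + 46 * (p - s) + 10 ∧
      ((σ'.reg ρok = 1 ∧ ∀ y, s ≤ y → y < p → Exits s p g y) ∨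
      (σ'.reg ρok = 0 ∧ ∃ y, s ≤ y ∧ y < p ∧ ¬ Exits s p g y)) := by
  obtain ⟨h1, h2⟩ := id hw
  obtain ⟨c0, c1, c2, c3, c4⟩ := id hc
  refine wp_cons (wp_add ⟨by omega, by omega, ?_⟩)
  refine wp_cons (wp_loop
    (fun σ' B' => ∃ k, s ≤ k ∧ k ≤ p ∧ CycleInv n s p g σ B k σ' B') ?_ ?_)
  · refine ⟨s, le_rfl, hsp, by simp [*], fun _ _ => rfl, ?_, .inl ⟨by simp [*],
      fun z hz hz' => ?_⟩⟩
    · have := unmarked_le (2 * n) s p σ.mem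
      simp only
      omega
    · simp only [hm z hz hz']
      exact ⟨by omega, by omega, by omega⟩
  · rintro σ' B' hf ⟨k, hk, hk', hI⟩
    have hc' := hc.of_frame (σ' := σ') (l := findCycle.writes) (fun r hr => by
      rw [hf r (by simp_all [findCycle, block, Stmt.writes])]
      simp_all [findCycle, block, Stmt.writes]) (by decide)
    have hp' : σ'.reg ρp = p := by rw [hf _ (by decide)]; simp [hp]
    have hb := hI.2.2.1
    refine ⟨by omega, fun hlt => ?_, fun hlt => wp_nil ?_⟩
    · simp only [Cond.Holds, hI.1, hp'] at hlt
      exact wp_cycleStep hw hc' (by rw [hf _ (by decide)]; simp [hs])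
        (by rw [hf _ (by decide)]; simp [ht]) hp' hk hlt hpn htn hg hB hI
    · simp only [Cond.Holds, hI.1, hp'] at hlt
      obtain rfl : k = p := by omega
      obtain ⟨-, hfr, -, h⟩ := hI
      refine ⟨hfr, by omega, h.imp (fun h => ⟨h.1, fun y hy hy' => ?_⟩) (fun h => ⟨h.1, h.2.2⟩)⟩
      have := h.2 y hy hy'
      exact this.2.1 (this.2.2 hy')

/-! ### Verification: test and search of target phrases -/

theorem wp_test {w : ℕ} {T : List ℕ} (hw : Fit w T.length) {P : List Phrase} (hP : IsPBP T P)
    {σ : State} {B t ℓ : ℕ} (hc : Consts T.length σ) (hs : σ.reg ρs = totalLength P)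
    (ht : σ.reg ρt = t) (hlen : σ.reg ρlen = ℓ) (h1 : 1 ≤ ℓ) (hℓ : ℓ ≤ T.length + 1)
    (htn : t < T.length) (hT : ∀ i < T.length, T[i]? = some (σ.mem i))
    (hr : ∀ x < T.length, RootOf (parent P) x (σ.mem (T.length + x)))
    -- Here 61 = 15 + 46: the comparison and the search for a cycle, per position.
    (hB : 61 * ℓ + 40 ≤ B) :
    WP w (5 * T.length) test σ B fun σ' B' =>
      (∀ a, a < 2 * T.length ∨ 3 * T.length ≤ a → σ'.mem a = σ.mem a) ∧
      B ≤ B' + 61 * ℓ + 40 ∧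
      ((σ'.reg ρok = 1 ∧ IsValidPBP T (P ++ [.target t ℓ])) ∨
      (σ'.reg ρok = 0 ∧ ¬ IsValidPBP T (P ++ [.target t ℓ]))) := by
  obtain ⟨w1, w2⟩ := id hw
  obtain ⟨c0, c1, c2, c3, c4⟩ := id hc
  have hPle := hP.le
  rw [isValidPBP_append_target_iff_exits hP (r := fun x => σ.mem (T.length + x)) hr]
  generalize totalLength P = s at *
  have fail : ∀ {E : Prop} (reg : ℕ → ℕ) (B' : ℕ), reg ρok = 0 → B ≤ B' + 40 → ¬ Fits T s t ℓ →
      (∀ a, a < 2 * T.length ∨ 3 * T.length ≤ a → (⟨reg, σ.mem⟩ : State).mem a = σ.mem a) ∧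
      B ≤ B' + 61 * ℓ + 40 ∧
      ((reg ρok = 1 ∧ Fits T s t ℓ ∧ E) ∨ (reg ρok = 0 ∧ ¬ (Fits T s t ℓ ∧ E))) :=
    fun reg B' h₁ h₂ h₃ =>
    ⟨fun _ _ => rfl, by omega, .inr ⟨h₁, fun h => h₃ h.1⟩⟩
  refine wp_cons (wp_const ⟨by omega, by omega, ?_⟩)
  refine wp_cons (wp_ite (by omega) (fun heq => wp_skip (wp_nil ?_)) (fun heq => ?_))
  · simp [Cond.Holds, hs, ht] at heq
    exact fail _ _ (by simp) (by omega) fun h => h.2.1 heq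
  simp [Cond.Holds, hs, ht] at heq
  refine wp_cons (wp_add ⟨by omega, by simp [*]; omega, ?_⟩)
  refine wp_cons (wp_add ⟨by omega, by simp [*]; omega, ?_⟩)
  refine wp_cons (wp_ite (by omega) (fun hp => wp_skip (wp_nil (wp_nil ?_))) (fun hp => ?_))
  · simp [Cond.Holds, hs, c0, hlen] at hp
    exact fail _ _ (by simp) (by omega) fun h => by have := h.2.2.1; omega
  refine wp_ite (by omega) (fun hq => wp_skip (wp_nil (wp_nil ?_))) (fun hq => ?_)
  · simp [Cond.Holds, ht, c0, hlen] at hq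
    exact fail _ _ (by simp) (by omega) fun h => by have := h.2.2.2.1; omega
  simp [Cond.Holds, hs, c0, hlen] at hp
  simp [Cond.Holds, ht, c0, hlen] at hq
  refine wp_cons (wp_const ⟨by omega, by omega, ?_⟩)
  refine wp_cons (WP.conseq (wp_compare hw (s := s) (t := t) (ℓ := ℓ)
    ⟨by simp [*], by simp [*], by simp [*], by simp [*], by simp [*]⟩ (by simp [*]) (by simp [*])
    (by simp [*]) hp hq (by simp) (by omega)) ?_)
  rintro σ₁ B₁ hf₁ ⟨hm₁, hz₁, hfr₁, hb₁⟩
  simp only at hm₁ hfr₁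
  have hc₁ := hc.of_frame (σ' := σ₁) (l := test.writes) (fun r hr => by
      rw [hf₁ r (by simp_all [test, block, Stmt.writes])]
      simp_all [test, block, Stmt.writes]) (by decide)
  have hmatch : (∀ k < ℓ, T[s + k]? = T[t + k]?) ↔ ∀ k < ℓ, σ.mem (s + k) = σ.mem (t + k) := by
    refine forall₂_congr fun k hk => ?_
    rw [hT _ (by omega), hT _ (by omega), Option.some_inj]
  refine wp_cons (wp_ite (by omega) (fun hok => ?_) (fun hok => wp_skip (wp_nil (wp_nil (wp_nil ?_)))))
  · simp only [Cond.Holds, hc₁.one_eq] at hok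
    have hall := (hm₁.resolve_right (by omega)).2
    refine WP.conseq (wp_findCycle hw (s := s) (t := t) (p := s + ℓ)
      (g := fun y => σ.mem (T.length + (t + (y - s)))) hc₁ (by rw [hf₁ _ (by decide)]; simp [*])
      (by rw [hf₁ _ (by decide)]; simp [*]) (by rw [hf₁ _ (by decide)]; simp [*]) (by omega) hp
      (by omega) (fun y hy hy' => hfr₁ _ (by omega)) hz₁ hok (by omega)) ?_
    rintro σ₂ B₂ - ⟨hfr₂, hb₂, hcase⟩
    refine wp_nil (wp_nil (wp_nil ⟨fun a ha => by rw [hfr₂ a ha, hfr₁ a ha], by omega, ?_⟩))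
    refine hcase.imp (fun h => ⟨h.1, ⟨h1, heq, hp, hq, hmatch.2 hall⟩, h.2⟩) (fun h => ⟨h.1, ?_⟩)
    rintro ⟨-, hex⟩
    obtain ⟨y, hy, hy', hn⟩ := h.2
    exact hn (hex y hy hy')
  · simp only [Cond.Holds, hc₁.one_eq] at hok
    obtain ⟨h0, k, hk, hne⟩ := hm₁.resolve_left (by omega)
    exact ⟨hfr₁, by omega, .inr ⟨h0, fun h => hne (hmatch.1 h.1.2.2.2.2 k hk)⟩⟩

/-- The maximal length `M` is unknown to the program and serves to bound the cost: every length
reached is at most `M`, so every test has length at most `M + 1`. The sum of the two pointers grows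
by exactly one. -/
theorem wp_searchStep {w : ℕ} {T : List ℕ} (hw : Fit w T.length) {P : List Phrase}
    (hP : IsPBP T P) {σ : State} {B M t l : ℕ} (hM : IsMaxTarget T P M) (hMn : M ≤ T.length)
    (hc : Consts T.length σ) (hs : σ.reg ρs = totalLength P) (ht : σ.reg ρt = t)
    (hl : σ.reg ρL = l) (htn : t < T.length) (hT : ∀ i < T.length, T[i]? = some (σ.mem i))
    (hr : ∀ x < T.length, RootOf (parent P) x (σ.mem (T.length + x)))
    (hL : l = 0 ∨ IsValidPBP T (P ++ [.target (σ.reg ρbest) l])) (hlM : l ≤ M)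
    (hno : ∀ t' < t, ¬ IsValidPBP T (P ++ [.target t' (l + 1)]))
    (hB : 61 * (M + 1) + 50 ≤ B) :
    WP w (5 * T.length) searchStep σ B fun σ' B' =>
      (∀ a, a < 2 * T.length ∨ 3 * T.length ≤ a → σ'.mem a = σ.mem a) ∧
      B ≤ B' + 61 * (M + 1) + 50 ∧
      ∃ t' l', σ'.reg ρt = t' ∧ σ'.reg ρL = l' ∧ t' ≤ T.length ∧ l' ≤ M ∧ t' + l' = t + l + 1 ∧
        (l' = 0 ∨ IsValidPBP T (P ++ [.target (σ'.reg ρbest) l'])) ∧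
        ∀ u < t', ¬ IsValidPBP T (P ++ [.target u (l' + 1)]) := by
  obtain ⟨w1, w2⟩ := id hw
  obtain ⟨c0, c1, c2, c3, c4⟩ := id hc
  refine wp_cons (wp_add ⟨by omega, by omega, ?_⟩)
  refine wp_cons (WP.conseq (wp_test hw hP (t := t) (ℓ := l + 1)
    ⟨by simp [*], by simp [*], by simp [*], by simp [*], by simp [*]⟩ (by simp [*]) (by simp [*])
    (by simp [*]) (by omega) (by omega) htn hT hr (by omega)) ?_)
  rintro σ₁ B₁ hf ⟨hfr, hb, hcase⟩
  have hc₁ := hc.of_frame (σ' := σ₁) (l := searchStep.writes) (fun r hr => by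
      rw [hf r (by simp_all [searchStep, block, Stmt.writes])]
      simp_all [searchStep, block, Stmt.writes]) (by decide)
  obtain ⟨d0, d1, d2, d3, d4⟩ := id hc₁
  have ht₁ : σ₁.reg ρt = t := by rw [hf _ (by decide)]; simp [*]
  have hl₁ : σ₁.reg ρL = l := by rw [hf _ (by decide)]; simp [*]
  have hlen₁ : σ₁.reg ρlen = l + 1 := by rw [hf _ (by decide)]; simp [*]
  have hbest₁ : σ₁.reg ρbest = σ.reg ρbest := by rw [hf _ (by decide)]; simp
  refine wp_cons (wp_ite (by omega) (fun hok => ?_) (fun hok => ?_))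
  · simp only [Cond.Holds, d2] at hok
    have hv := (hcase.resolve_right (by omega)).2
    refine wp_cons (wp_add ⟨by omega, by omega, ?_⟩)
    refine wp_cons (wp_add ⟨by omega, by simp [*]; omega, wp_nil (wp_nil ⟨hfr, by omega, t, l + 1,
      by simp [*], by simp [*], by omega, hM.2 _ _ hv, by omega, .inr (by simp [*]), ?_⟩)⟩)
    -- Positions refuted for length `l + 1` are refuted for `l + 2`, by shortening.
    exact fun u hu hv => hno u hu (hv.target_mono hP (by omega) (by omega))
  · simp only [Cond.Holds, d2] at hok
    have hv := (hcase.resolve_left (by omega)).2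
    refine wp_add ⟨by omega, by omega, wp_nil ⟨hfr, by omega, t + 1, l, by simp [*], by simp [*],
      by omega, hlM, by omega, by simp [*], fun u hu => ?_⟩⟩
    rcases Nat.lt_succ_iff_lt_or_eq.1 hu with h | rfl
    · exact hno u h
    · exact hv

/-- Neither pointer exceeds the length of the text, and their sum counts the tests. Hence there are
at most `2 * T.length` of them. -/
theorem wp_search {w : ℕ} {T : List ℕ} (hw : Fit w T.length) {P : List Phrase}
    (hP : IsPBP T P) {σ : State} {B M : ℕ} (hM : IsMaxTarget T P M) (hMn : M ≤ T.length)
    (hc : Consts T.length σ) (hs : σ.reg ρs = totalLength P)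
    (hT : ∀ i < T.length, T[i]? = some (σ.mem i))
    (hr : ∀ x < T.length, RootOf (parent P) x (σ.mem (T.length + x)))
    (hB : 2 * T.length * (61 * (M + 1) + 52) + 5 ≤ B) :
    WP w (5 * T.length) search σ B fun σ' B' =>
      (∀ a, a < 2 * T.length ∨ 3 * T.length ≤ a → σ'.mem a = σ.mem a) ∧
      B ≤ B' + 2 * T.length * (61 * (M + 1) + 52) + 5 ∧ σ'.reg ρL = M ∧
      (M = 0 ∨ IsValidPBP T (P ++ [.target (σ'.reg ρbest) M])) := by
  obtain ⟨w1, w2⟩ := id hw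
  obtain ⟨c0, c1, c2, c3, c4⟩ := id hc
  refine wp_cons (wp_const ⟨by omega, by omega, ?_⟩)
  refine wp_cons (wp_const ⟨by omega, by omega, ?_⟩)
  refine wp_cons (wp_const ⟨by omega, by omega, ?_⟩)
  refine wp_cons (wp_loop (fun σ' B' =>
    (∀ a, a < 2 * T.length ∨ 3 * T.length ≤ a → σ'.mem a = σ.mem a) ∧
    ∃ t l, σ'.reg ρt = t ∧ σ'.reg ρL = l ∧ t ≤ T.length ∧ l ≤ M ∧
      B ≤ B' + (t + l) * (61 * (M + 1) + 52) + 3 ∧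
      (l = 0 ∨ IsValidPBP T (P ++ [.target (σ'.reg ρbest) l])) ∧
      ∀ u < t, ¬ IsValidPBP T (P ++ [.target u (l + 1)])) ?_ ?_)
  · exact ⟨fun _ _ => rfl, 0, 0, by simp, by simp, by omega, by omega, by omega, .inl rfl,
      by omega⟩
  · rintro σ' B' hf ⟨hfr, t, l, ht, hl, htn, hlM, hb, hL, hno⟩
    have hc' := hc.of_frame (σ' := σ') (l := search.writes) (fun r hr => by
      rw [hf r (by simp_all [search, block, Stmt.writes])]
      simp_all [search, block, Stmt.writes]) (by decide)
    have hle : (t + l) * (61 * (M + 1) + 52) ≤ 2 * T.length * (61 * (M + 1) + 52) :=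
      Nat.mul_le_mul_right _ (by omega)
    refine ⟨by omega, fun hlt => ?_, fun hlt => wp_nil ?_⟩
    · simp only [Cond.Holds, ht, hc'.n_eq] at hlt
      have hle' : (t + l + 1) * (61 * (M + 1) + 52) ≤ 2 * T.length * (61 * (M + 1) + 52) :=
        Nat.mul_le_mul_right _ (by omega)
      rw [Nat.add_one_mul] at hle'
      refine (wp_searchStep hw hP hM hMn hc' (by rw [hf _ (by decide)]; simp [hs]) ht hl hlt
        (fun i hi => by rw [hfr _ (by omega), hT i hi])
        (fun x hx => by rw [hfr _ (by omega)]; exact hr x hx) hL hlM hno (by omega)).conseq ?_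
      rintro σ₁ B₁ - ⟨hfr₁, hb₁, t', l', h₁, h₂, h₃, h₄, h₅, h₆, h₇⟩
      refine ⟨fun a ha => by rw [hfr₁ a ha, hfr a ha], t', l', h₁, h₂, h₃, h₄, ?_, h₆, h₇⟩
      rw [h₅, Nat.add_one_mul]
      omega
    · simp only [Cond.Holds, ht, hc'.n_eq] at hlt
      obtain rfl : t = T.length := by omega
      -- All reference positions have been refuted for length `l + 1`, so `l` is maximal and equals
      -- `M`.
      have hmax := isMaxTarget_of_forall_not hP (hL.imp_right fun h => ⟨_, h⟩) hno
      obtain rfl : l = M := by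
        rcases hM.1 with h | ⟨u, hu⟩
        · omega
        · have := hmax.2 _ _ hu
          omega
      exact ⟨hfr, by omega, hl, hL⟩

/-! ### Verification: maintenance of the table of roots -/

/-- Replacing the root `s` by `v` in the table of roots. -/
theorem wp_replace {w n : ℕ} (hw : Fit w n) {σ : State} {B : ℕ} (hc : Consts n σ)
    (hi : σ.reg ρi = 0) (hB : 12 * n + 2 ≤ B) :
    WP w (5 * n) (.loop (.lt ρi ρn) replaceStep) σ B fun σ' B' =>
      (∀ a, a < n ∨ 2 * n ≤ a → σ'.mem a = σ.mem a) ∧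
      (∀ x < n, σ'.mem (n + x) =
        if σ.mem (n + x) = σ.reg ρs then σ.reg ρv else σ.mem (n + x)) ∧
      B ≤ B' + 12 * n + 2 := by
  obtain ⟨w1, w2⟩ := id hw
  refine wp_loop (fun σ' B' => ∃ i ≤ n, σ'.reg ρi = i ∧
    (∀ a, a < n ∨ n + i ≤ a → σ'.mem a = σ.mem a) ∧
    (∀ x < i, σ'.mem (n + x) =
      if σ.mem (n + x) = σ.reg ρs then σ.reg ρv else σ.mem (n + x)) ∧
    B ≤ B' + 12 * i) ?_ ?_
  · exact ⟨0, by omega, hi, fun _ _ => rfl, by omega, by omega⟩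
  · rintro σ' B' hf ⟨i, hi, hri, hfr, hx, hb⟩
    obtain ⟨c0, c1, c2, c3, c4⟩ := hc.of_frame hf (by decide)
    have hs := hf ρs (by decide)
    have hv := hf ρv (by decide)
    refine ⟨by omega, fun hlt => ?_, fun hlt => ?_⟩
    · simp only [Cond.Holds, hri, c0] at hlt
      have e := hfr (n + i) (by omega)
      refine wp_cons (wp_add ⟨by omega, by omega, ?_⟩)
      refine wp_cons (wp_load ⟨by omega, by simp [*]; omega, ?_⟩)
      refine wp_cons (wp_ite (by omega)
        (fun heq => wp_store ⟨by omega, by simp [*]; omega, ?_⟩) (fun heq => wp_skip ?_))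
      · simp [Cond.Holds, c0, hri, e, hs] at heq
        refine wp_cons (wp_add ⟨by omega, by simp [*]; omega, wp_nil ⟨i + 1, by omega,
          by simp [*], fun a ha => ?_, fun x hx' => ?_, by omega⟩⟩)
        · simp [Function.update_apply, c0, hri, hv]
          rw [if_neg (by omega), hfr a (by omega)]
        · simp [Function.update_apply, c0, hri, hv]
          split_ifs with h₁ h₂ h₂
          · rfl
          · rw [h₁] at h₂
            exact absurd heq h₂
          · rw [hx x (by omega), if_pos h₂]
          · rw [hx x (by omega), if_neg h₂]
      · simp [Cond.Holds, c0, hri, e, hs] at heq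
        refine wp_cons (wp_add ⟨by omega, by simp [*]; omega, wp_nil ⟨i + 1, by omega,
          by simp [*], fun a ha => hfr a (by omega), fun x hx' => ?_, by omega⟩⟩)
        rcases Nat.lt_succ_iff_lt_or_eq.1 hx' with h | rfl
        · exact hx x h
        · simp only [if_neg heq]
          exact e
    · simp only [Cond.Holds, hri, c0] at hlt
      obtain rfl : i = n := by omega
      exact ⟨fun a ha => hfr a (by omega), hx, by omega⟩

/-- A full scan for each new reference is affordable, because each position of the text receives at
most one reference during the whole run. -/
theorem wp_linkStep {w n : ℕ} (hw : Fit w n) {σ : State} {B a b : ℕ} {par : ℕ → ℕ}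
    (hc : Consts n σ) (hs : σ.reg ρs = a) (hy : σ.reg ρy = b) (han : a < n) (hbn : b < n)
    (ha : par a = a) (hab : b ≠ a) (hr : ∀ x < n, RootOf par x (σ.mem (n + x)))
    (hz : ∃ z, RootOf (Function.update par a b) a z) (hB : 12 * n + 10 ≤ B) :
    WP w (5 * n) linkStep σ B fun σ' B' =>
      (∀ a, a < n ∨ 2 * n ≤ a → σ'.mem a = σ.mem a) ∧
      (∀ x < n, RootOf (Function.update par a b) x (σ'.mem (n + x))) ∧
      σ'.reg ρs = a + 1 ∧ σ'.reg ρy = b + 1 ∧ B ≤ B' + 12 * n + 10 := by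
  obtain ⟨w1, w2⟩ := id hw
  obtain ⟨c0, c1, c2, c3, c4⟩ := id hc
  refine wp_cons (wp_add ⟨by omega, by omega, ?_⟩)
  refine wp_cons (wp_load ⟨by omega, by simp [*]; omega, ?_⟩)
  refine wp_cons (wp_const ⟨by omega, by omega, ?_⟩)
  refine wp_cons (WP.conseq (wp_replace hw
    ⟨by simp [*], by simp [*], by simp [*], by simp [*], by simp [*]⟩ (by simp) (by omega)) ?_)
  rintro σ₁ B₁ hf ⟨hfr, hx, hb⟩
  have hone : σ₁.reg ρone = 1 := by rw [hf _ (by decide)]; simp [*]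
  have hs₁ : σ₁.reg ρs = a := by rw [hf _ (by decide)]; simp [*]
  have hy₁ : σ₁.reg ρy = b := by rw [hf _ (by decide)]; simp [*]
  refine wp_cons (wp_add ⟨by omega, by omega, ?_⟩)
  refine wp_cons (wp_add ⟨by omega, by simp [*]; omega, wp_nil ⟨hfr, fun x hx' => ?_, by simp [*],
    by simp [*], by omega⟩⟩)
  have := rootOf_update ha hab hbn hr hz x hx'
  simp [c0, hs, hy] at hx
  rwa [← hx x hx'] at this

theorem wp_link {w n : ℕ} (hw : Fit w n) {σ : State} {B s t ℓ : ℕ} {par : ℕ → ℕ}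
    (hc : Consts n σ) (hs : σ.reg ρs = s) (ht : σ.reg ρbest = t) (hℓ : σ.reg ρL = ℓ)
    (hsn : s + ℓ ≤ n) (htn : t + ℓ ≤ n) (hts : t ≠ s) (hpar : ∀ x, s ≤ x → par x = x)
    (hr : ∀ x < n, RootOf par x (σ.mem (n + x)))
    (hv : ∀ x < n, ∃ y, RootOf (graft par s t ℓ) x y) (hB : ℓ * (12 * n + 12) + 5 ≤ B) :
    WP w (5 * n) link σ B fun σ' B' =>
      (∀ a, a < n ∨ 2 * n ≤ a → σ'.mem a = σ.mem a) ∧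
      (∀ x < n, RootOf (graft par s t ℓ) x (σ'.mem (n + x))) ∧
      σ'.reg ρs = s + ℓ ∧ B ≤ B' + ℓ * (12 * n + 12) + 5 := by
  obtain ⟨w1, w2⟩ := id hw
  obtain ⟨c0, c1, c2, c3, c4⟩ := id hc
  refine wp_cons (wp_add ⟨by omega, by omega, ?_⟩)
  refine wp_cons (wp_add ⟨by omega, by simp [*]; omega, ?_⟩)
  refine wp_cons (wp_loop (fun σ' B' => ∃ j ≤ ℓ, σ'.reg ρs = s + j ∧ σ'.reg ρy = t + j ∧
    (∀ a, a < n ∨ 2 * n ≤ a → σ'.mem a = σ.mem a) ∧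
    (∀ x < n, RootOf (graft par s t j) x (σ'.mem (n + x))) ∧
    B ≤ B' + j * (12 * n + 12) + 2) ?_ ?_)
  · refine ⟨0, by omega, by simp [*], by simp [*], fun _ _ => rfl, ?_, by omega⟩
    rwa [graft_zero]
  · rintro σ' B' hf ⟨j, hj, hs', hy', hfr, hr', hb⟩
    have hc' := hc.of_frame (σ' := σ') (l := link.writes) (fun r hr => by
      rw [hf r (by simp_all [link, block, Stmt.writes])]
      simp_all [link, block, Stmt.writes]) (by decide)
    have he : σ'.reg ρe = s + ℓ := by rw [hf _ (by decide)]; simp [*]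
    have hle : j * (12 * n + 12) ≤ ℓ * (12 * n + 12) := Nat.mul_le_mul_right _ hj
    refine ⟨by omega, fun hlt => ?_, fun hlt => wp_nil ?_⟩
    · simp only [Cond.Holds, hs', he] at hlt
      have hle' : (j + 1) * (12 * n + 12) ≤ ℓ * (12 * n + 12) :=
        Nat.mul_le_mul_right _ (by omega)
      rw [Nat.add_one_mul] at hle'
      refine (wp_linkStep hw hc' hs' hy' (by omega) (by omega)
        (by rw [graft, if_neg (by omega), hpar _ (by omega)]) (by omega) hr' ?_ (by omega)).conseq ?_
      -- The references are added one at a time, and every intermediate graph is a subgraph of the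
      -- final forest, hence a forest.
      · rw [← graft_succ]
        obtain ⟨z, hz⟩ := hv (s + j) (by omega)
        exact hz.exists_of_le (graft_le hpar (by omega))
      · rintro σ₁ B₁ - ⟨hfr₁, hr₁, hs₁, hy₁, hb₁⟩
        rw [← graft_succ] at hr₁
        refine ⟨j + 1, by omega, hs₁, hy₁, fun a ha => by rw [hfr₁ a ha, hfr a ha], hr₁, ?_⟩
        rw [Nat.add_one_mul]
        omega
    · simp only [Cond.Holds, hs', he] at hlt
      obtain rfl : j = ℓ := by omega
      exact ⟨hfr, hr', hs', by omega⟩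

/-! ### Verification: the main loop -/

/-- The state of the machine after the phrases `P` have been found. -/
structure Progress (T : List ℕ) (P : List Phrase) (σ : State) : Prop where
  s_eq : σ.reg ρs = totalLength P
  cnt_eq : σ.reg ρcnt = P.length
  o_eq : σ.reg ρo = 3 * T.length + 2 * P.length
  valid : IsValidPBP T P
  lp : ∀ (p : ℕ) (hp : p < P.length), IsLP T (P.take p) P[p]
  -- Phrases are not empty. Therefore there are at most `T.length` of them and the output fits into
  -- `2 * T.length` cells.
  length_le : P.length ≤ totalLength P
  text : ∀ i < T.length, T[i]? = some (σ.mem i)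
  roots : ∀ x < T.length, RootOf (parent P) x (σ.mem (T.length + x))
  out : P = (List.range P.length).map fun p =>
    Phrase.decode (σ.mem (3 * T.length + 2 * p)) (σ.mem (3 * T.length + 2 * p + 1))

/-- Advancing the output pointer and the counter after the phrase `f` has been stored. -/
theorem Progress.wp_append {w : ℕ} {T : List ℕ} (hw : Fit w T.length) {P : List Phrase}
    {f : Phrase} {σ σ' : State} {B : ℕ} (h : Progress T P σ) (hc : Consts T.length σ')
    (hs : σ'.reg ρs = totalLength (P ++ [f])) (hcnt : σ'.reg ρcnt = P.length)
    (ho : σ'.reg ρo = 3 * T.length + 2 * P.length + 1) (hf : IsLP T P f) (hf1 : 1 ≤ f.length)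
    (hfr : ∀ a, a < T.length ∨ (3 * T.length ≤ a ∧ a < 3 * T.length + 2 * P.length) →
      σ'.mem a = σ.mem a)
    (hr : ∀ x < T.length, RootOf (parent (P ++ [f])) x (σ'.mem (T.length + x)))
    (hout : f = Phrase.decode (σ'.mem (3 * T.length + 2 * P.length))
      (σ'.mem (3 * T.length + 2 * P.length + 1))) (hB : 2 ≤ B) :
    WP w (5 * T.length) (block [.add ρo ρo ρone, .add ρcnt ρcnt ρone]) σ' B fun σ' B' =>
      Progress T (P ++ [f]) σ' ∧ B ≤ B' + 2 := by
  obtain ⟨w1, w2⟩ := id hw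
  obtain ⟨c0, c1, c2, c3, c4⟩ := id hc
  have hle := h.valid.1.le
  have hle' := h.length_le
  refine wp_cons (wp_add ⟨by omega, by omega, ?_⟩)
  refine wp_cons (wp_add ⟨by omega, by simp [*]; omega, wp_nil ⟨⟨by simp [*], by simp [*],
    by simp [*]; omega, hf.1, fun p hp => ?_, ?_, fun i hi => ?_, hr, ?_⟩, by omega⟩⟩)
  · rw [List.length_append, List.length_singleton] at hp
    rw [List.take_append_of_le_length (by omega)]
    rcases Nat.lt_succ_iff_lt_or_eq.1 hp with hp' | rfl
    · rw [List.getElem_append_left hp']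
      exact h.lp p hp'
    · simpa using hf
  · rw [totalLength_append, List.length_append, totalLength_cons, List.length_singleton]
    omega
  · rw [h.text i hi, ← hfr i (.inl hi)]
  · rw [List.length_append, List.length_singleton, List.range_succ, List.map_append,
      List.map_singleton, ← hout]
    congr 1
    conv_lhs => rw [h.out]
    refine List.map_congr_left fun p hp => ?_
    rw [List.mem_range] at hp
    simp only
    rw [hfr _ (.inr ⟨by omega, by omega⟩), hfr _ (.inr ⟨by omega, by omega⟩)]

theorem wp_phraseStep {w : ℕ} {T : List ℕ} (hw : Fit w T.length) {P : List Phrase} {σ : State}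
    {B : ℕ} (hc : Consts T.length σ) (h : Progress T P σ) (hs : totalLength P < T.length)
    (hB : 400 * T.length * (T.length - totalLength P) ≤ B) :
    WP w (5 * T.length) phraseStep σ B fun σ' B' => ∃ m, totalLength P + m ≤ T.length ∧
      B ≤ B' + 400 * T.length * m ∧ 1 ≤ m ∧
      ∃ P', totalLength P' = totalLength P + m ∧ Progress T P' σ' := by
  obtain ⟨w1, w2⟩ := id hw
  obtain ⟨M, hM⟩ := exists_isMaxTarget h.valid.1
  have hMn : totalLength P + M ≤ T.length := by
    rcases hM.1 with h' | ⟨t, ht⟩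
    · omega
    · exact ((isValidPBP_append_target h.valid.1).1 ht).1.2.2.1
  have hlen := h.length_le
  -- The length of the next phrase: `M = 0` stands for a character, of length 1.
  obtain ⟨m, hm⟩ : ∃ m, m = max M 1 := ⟨_, rfl⟩
  -- With `M ≤ m` and `1 ≤ m`, the terms contribute 134 + 226 + 12 + 28 = 400. Thus a phrase costs
  -- at most `400 * T.length` for each position that it covers.
  have hcost : 2 * T.length * (61 * (M + 1) + 52) + M * (12 * T.length + 12) + 28 ≤
      400 * T.length * m := by
    have h₁ : M * T.length ≤ m * T.length := Nat.mul_le_mul_right _ (by omega)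
    have h₂ : 1 * T.length ≤ m * T.length := Nat.mul_le_mul_right _ (by omega)
    have h₃ : m * 1 ≤ m * T.length := Nat.mul_le_mul_left _ w1
    nlinarith
  have hBm : 400 * T.length * m ≤ B := le_trans (Nat.mul_le_mul_left _ (by omega)) hB
  refine wp_cons (WP.conseq (wp_search hw h.valid.1 hM (by omega) hc h.s_eq h.text h.roots
    (by omega)) ?_)
  rintro σ₁ B₁ hf ⟨hfr, hb, hL, hbest⟩
  have hc₁ := hc.of_frame hf (by decide)
  obtain ⟨c0, c1, c2, c3, c4⟩ := id hc₁
  have hs₁ : σ₁.reg ρs = totalLength P := by rw [hf _ (by decide), h.s_eq]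
  have ho₁ : σ₁.reg ρo = 3 * T.length + 2 * P.length := by rw [hf _ (by decide), h.o_eq]
  have hcnt₁ : σ₁.reg ρcnt = P.length := by rw [hf _ (by decide), h.cnt_eq]
  refine wp_cons (wp_ite (by omega) (fun h0 => ?_) (fun h0 => ?_))
  · simp only [Cond.Holds, hL, c3] at h0
    subst h0
    refine wp_cons (wp_load ⟨by omega, by omega, ?_⟩)
    refine wp_cons (wp_store ⟨by omega, by simp [*]; omega, ?_⟩)
    refine wp_cons (wp_add ⟨by omega, by simp [*]; omega, ?_⟩)
    refine wp_cons (wp_store ⟨by omega, by simp [*]; omega, ?_⟩)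
    refine wp_cons (wp_add ⟨by omega, by simp [*]; omega, wp_nil ?_⟩)
    have hchar : T[totalLength P]? = some (σ₁.mem (totalLength P)) := by
      rw [hfr _ (by omega), h.text _ hs]
    refine (h.wp_append hw (f := .char (σ₁.mem (totalLength P)))
      ⟨by simp [*], by simp [*], by simp [*], by simp [*], by simp [*]⟩
      (by simp [*, Phrase.length, totalLength])
      (by simp [*]) (by simp [*]) (hM.isLP_char h.valid hchar) le_rfl (fun a ha => ?_)
      (fun x hx => ?_) ?_ (by omega)).conseq ?_
    · simp [Function.update_apply, ho₁, c2]
      rw [if_neg (by omega), if_neg (by omega), hfr a (by omega)]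
    · rw [show P ++ [.char (σ₁.mem (totalLength P))] = P ++ [σ₁.mem (totalLength P)].map Phrase.char
        from rfl, parent_append_map_char]
      simp [Function.update_apply, ho₁, c2]
      rw [if_neg (by omega), if_neg (by omega), hfr _ (by omega)]
      exact h.roots x hx
    · simp [ho₁, c2, c3, hs₁, Phrase.decode]
    · rintro σ₂ B₂ - ⟨hP, hb₂⟩
      refine ⟨m, by omega, by omega, by omega, _, ?_, hP⟩
      simp [Phrase.length, totalLength, hm]
  · simp only [Cond.Holds, hL, c3] at h0
    have hv := hbest.resolve_left h0
    obtain ⟨t, ht⟩ : ∃ t, σ₁.reg ρbest = t := ⟨_, rfl⟩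
    rw [ht] at hv
    obtain ⟨⟨f₁, f₂, f₃, f₄, f₅⟩, hroot⟩ := (isValidPBP_append_target h.valid.1).1 hv
    refine wp_cons (wp_store ⟨by omega, by omega, ?_⟩)
    refine wp_cons (wp_add ⟨by omega, by simp [*]; omega, ?_⟩)
    refine wp_cons (wp_store ⟨by omega, by simp [*]; omega, ?_⟩)
    refine wp_cons (WP.conseq (wp_link hw (s := totalLength P) (t := t) (ℓ := M)
      (par := parent P) ⟨by simp [*], by simp [*], by simp [*], by simp [*], by simp [*]⟩
      (by simp [*]) (by simp [*]) (by simp [*]) f₃ f₄ f₂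
      (fun x hx => parent_of_totalLength_le hx) (fun x hx => ?_) hroot (by omega)) ?_)
    · simp [Function.update_apply, ho₁, c2]
      rw [if_neg (by omega), if_neg (by omega), hfr _ (by omega)]
      exact h.roots x hx
    rintro σ₂ B₂ hf₂ ⟨hfr₂, hr₂, hs₂, hb₂⟩
    simp [Function.update_apply, ho₁, c2, ht, hL] at hfr₂
    have hc₂ := hc₁.of_frame (σ' := σ₂) (l := phraseStep.writes) (fun r hr => by
      rw [hf₂ r (by simp_all [phraseStep, block, Stmt.writes])]
      simp_all [phraseStep, block, Stmt.writes]) (by decide)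
    refine wp_nil ((h.wp_append hw (f := .target t M) hc₂
      (by simp [*, Phrase.length, totalLength])
      (by rw [hf₂ _ (by decide)]; simp [*]) (by rw [hf₂ _ (by decide)]; simp [*])
      (hM.isLP_target h0 hv) f₁ (fun a ha => ?_)
      (by rwa [parent_append_target]) ?_ (by omega)).conseq ?_)
    · rw [hfr₂ a (by omega), if_neg (by omega), if_neg (by omega), hfr a (by omega)]
    · rw [hfr₂ _ (by omega), hfr₂ _ (by omega)]
      simp [Phrase.decode, h0]
    · rintro σ₃ B₃ - ⟨hP, hb₃⟩
      refine ⟨m, by omega, by omega, by omega, _, ?_, hP⟩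
      simp [Phrase.length, totalLength, hm]
      omega

theorem wp_init {w n : ℕ} (hw : Fit w n) {σ : State} {B : ℕ} (hc : Consts n σ)
    (hi : σ.reg ρi = 0) (hB : 5 * n + 2 ≤ B) :
    WP w (5 * n) (.loop (.lt ρi ρn) initStep) σ B fun σ' B' =>
      (∀ a < n, σ'.mem a = σ.mem a) ∧ (∀ x < n, σ'.mem (n + x) = x) ∧ B ≤ B' + 5 * n + 2 := by
  obtain ⟨w1, w2⟩ := id hw
  refine wp_loop (fun σ' B' => ∃ i ≤ n, σ'.reg ρi = i ∧ (∀ a < n, σ'.mem a = σ.mem a) ∧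
    (∀ x < i, σ'.mem (n + x) = x) ∧ B ≤ B' + 5 * i) ?_ ?_
  · exact ⟨0, by omega, hi, fun _ _ => rfl, by omega, by omega⟩
  · rintro σ' B' hf ⟨i, hi, hri, hfr, hx, hb⟩
    obtain ⟨c0, c1, c2, c3, c4⟩ := hc.of_frame hf (by decide)
    refine ⟨by omega, fun hlt => ?_, fun hlt => ?_⟩
    · simp only [Cond.Holds, hri, c0] at hlt
      refine wp_cons (wp_add ⟨by omega, by omega, ?_⟩)
      refine wp_cons (wp_store ⟨by omega, by simp [*]; omega, ?_⟩)
      refine wp_cons (wp_add ⟨by omega, by simp [*]; omega, wp_nil ⟨i + 1, by omega,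
        by simp [*], fun a ha => ?_, fun x hx' => ?_, by omega⟩⟩)
      · simp [Function.update_apply, c0, hri]
        rw [if_neg (by omega), hfr a ha]
      · simp [Function.update_apply, c0, hri]
        split_ifs with h₁
        · exact h₁.symm
        · exact hx x (by omega)
    · simp only [Cond.Holds, hri, c0] at hlt
      obtain rfl : i = n := by omega
      exact ⟨hfr, hx, by omega⟩

theorem wp_main {w : ℕ} {T : List ℕ} (hw : Fit w T.length) {σ : State} {B : ℕ}
    (hn : σ.reg ρn = T.length) (hT : ∀ i < T.length, T[i]? = some (σ.mem i))
    (hB : 402 * T.length * T.length + 5 * T.length + 20 ≤ B) :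
    WP w (5 * T.length) main σ B fun σ' _ => ∃ P, IsLZRR T P ∧ P.length ≤ T.length ∧
      σ'.reg 0 = P.length ∧ σ'.reg 1 = 3 * T.length ∧
      P = (List.range P.length).map fun p =>
        Phrase.decode (σ'.mem (3 * T.length + 2 * p)) (σ'.mem (3 * T.length + 2 * p + 1)) := by
  obtain ⟨w1, w2⟩ := id hw
  refine wp_cons (wp_const ⟨by omega, by omega, ?_⟩)
  refine wp_cons (wp_const ⟨by omega, by omega, ?_⟩)
  refine wp_cons (wp_add ⟨by omega, by simp [*]; omega, ?_⟩)
  refine wp_cons (wp_add ⟨by omega, by simp [*]; omega, ?_⟩)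
  refine wp_cons (wp_const ⟨by omega, by omega, ?_⟩)
  refine wp_cons (WP.conseq (wp_init hw ⟨by simp [*], by simp [*]; omega, by simp, by simp,
    by simp [*]; omega⟩ (by simp) (by omega)) ?_)
  rintro σ₁ B₁ hf ⟨hfr, hx, hb⟩
  simp only at hfr
  have hc₁ : Consts T.length σ₁ := Consts.of_frame ⟨by simp [*], by simp [*]; omega, by simp,
    by simp, by simp [*]; omega⟩ hf (by decide)
  clear hf
  obtain ⟨c0, c1, c2, c3, c4⟩ := id hc₁
  refine wp_cons (wp_const ⟨by omega, by omega, ?_⟩)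
  refine wp_cons (wp_const ⟨by omega, by omega, ?_⟩)
  refine wp_cons (wp_add ⟨by omega, by simp [*]; omega, ?_⟩)
  refine wp_cons (wp_loop (fun σ' B' => ∃ P, Progress T P σ' ∧
    -- Each remaining position holds `400 * T.length` credits for its phrase and at least 2 more for
    -- the test of the loop; the last 5 pay for leaving it.
    402 * T.length * (T.length - totalLength P) + 5 ≤ B') ?_ ?_)
  · refine ⟨[], ⟨by simp [totalLength], by simp, by simp [*], isValidPBP_nil T, by simp, by simp,
      fun i hi => ?_, fun x hx' => ?_, by simp⟩, ?_⟩
    · rw [hT i hi, ← hfr i hi]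
    · simp only [hx x hx']
      exact .base (parent_of_totalLength_le (Nat.zero_le x))
    · simp only [totalLength, List.map_nil, List.sum_nil, Nat.sub_zero]
      omega
  · rintro σ' B' hf ⟨P, hP, hb'⟩
    have hc' := hc₁.of_frame (σ' := σ') (l := ρs :: ρcnt :: ρo :: phraseStep.writes)
      (fun r hr => by
        rw [hf r (by simp_all)]
        simp_all) (by decide)
    have hle := hP.valid.1.le
    refine ⟨by omega, fun hlt => ?_, fun hlt => ?_⟩
    · simp only [Cond.Holds, hP.s_eq, hc'.n_eq] at hlt
      have hd : 1 * (T.length - totalLength P) ≤ T.length * (T.length - totalLength P) :=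
        Nat.mul_le_mul_right _ w1
      rw [Nat.mul_assoc] at hb'
      refine (wp_phraseStep hw hc' hP hlt (by rw [Nat.mul_assoc]; omega)).conseq ?_
      rintro σ₂ B₂ - ⟨m, hm, hb₂, hm1, P', hP', hprog⟩
      refine ⟨P', hprog, ?_⟩
      have hnm : 1 * m ≤ T.length * m := Nat.mul_le_mul_right _ w1
      have hsplit : T.length * (T.length - totalLength P) =
          T.length * (T.length - totalLength P') + T.length * m := by
        rw [← Nat.mul_add]
        congr 1
        omega
      rw [Nat.mul_assoc] at hb₂ ⊢
      omega
    · simp only [Cond.Holds, hP.s_eq, hc'.n_eq] at hlt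
      have htot : totalLength P = T.length := by omega
      have hlen := hP.length_le
      have hcnt := hP.cnt_eq
      have hzero := hc'.zero_eq
      exact wp_cons (wp_add ⟨by omega, by omega, wp_nil ⟨P, ⟨hP.valid.isValidBP htot, hP.lp⟩,
        by omega, by simp [*], by simp [hc'.out_eq], hP.out⟩⟩)

end LZRR

/-! ### The final bound -/

theorem theorem1 :
    ∃ (prog : WordRAM.Program) (C K : ℕ),
      ∀ (w : ℕ) (T : List ℕ), T ≠ [] → (∀ c ∈ T, c < 2 ^ w) → K * T.length ≤ 2 ^ w →
        ∃ B : List Phrase,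
          LZRR.IsLZRR T B ∧
          WordRAM.Computes w prog T
            (C * (T.length ^ 2 * LZRR.invAck (T.length ^ 2) (T.length ^ 2)))
            (C * T.length) B := by
  -- As `1 ≤ T.length`, the constant 430 covers 402 + 5 + 20 for the time, and also the 5 cells per
  -- position. The constant 8 is that of `Fit`.
  refine ⟨LZRR.main.compile 0, 430, 8, fun w T hT _ hw => ?_⟩
  have hpos : 1 ≤ T.length := List.length_pos_of_ne_nil hT
  have hsq : T.length * 1 ≤ T.length * T.length := Nat.mul_le_mul_left _ hpos
  obtain ⟨t, ht, σ, -, ⟨P, hP, hlen, h0, h1, hout⟩, hrun, haddr⟩ :=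
    (LZRR.wp_main (w := w) (T := T) ⟨hpos, hw⟩ (σ := ⟨(WordRAM.init T).reg, (WordRAM.init T).mem⟩)
      (B := 430 * (T.length * T.length)) (by simp [WordRAM.init])
      (fun i hi => by simp [WordRAM.init, hi]) (by rw [Nat.mul_assoc]; omega)).exists_iterate
  refine ⟨P, hP, t, ?_, ?_⟩
  -- The Ackermann factor is 1, so the quadratic bound is the one required.
  · rwa [LZRR.invAck_self, Nat.mul_one, pow_two]
  · change (WordRAM.step w _)^[t] (WordRAM.init T) = _ at hrun
    simp only [hrun]
    refine ⟨le_rfl, fun s hs a ha => (haddr s hs a ha).trans_le (by omega), ?_, ?_⟩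
    · simp only [WordRAM.State.at, h0, h1]
      omega
    · simp only [WordRAM.State.at, h0, h1]
      exact hout
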